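/- Let $\varphi(t)=\exp\Bigl(-4\int_0^1\sin^2\bigl(\tfrac{tv}{2}\bigr)\,\tfrac{dv}{v}\Bigr)$ for $t\in\mathbb R$. Let $p_n$ be the $n$-th prime number, and let $(\eta_p)$, with $p$ running over the primes, be independent real random variables on a probability space $(\Omega,\mathbb P)$ such that $$\mathbb P[\eta_p=1]=\mathbb P[\eta_p=-1]=\frac{p}{(p+1)^2},\qquad \mathbb P[\eta_p=0]=\frac{p^2+1}{(p+1)^2}.$$ For $n\ge 1$ put $X_n=\sum_{p\le p_n}\eta_p\log p$, the sum being over primes. Then $\varphi$ is integrable on $\mathbb R$; there is a constant $C\ge 0$ with $|\varphi(t)|\le C|t|^{-2}$ for all real $t\neq 0$; $\varphi$ is the characteristic function of a probability measure $\mu$ on $\mathbb R$; and the sequence $(X_n)$ satisfies mod-$\varphi$ convergence with $d=1$ and $A_n(t)=A_n^*(t)=(\log p_n)\,t$. Here mod-$\varphi$ convergence of a sequence $(X_n)_{n\ge1}$ of $\mathbb R^d$-valued random variables with characteristic functions $\varphi_n$, with respect to linear automorphisms $A_n$ of $\mathbb R^d$ with inverses $\Sigma_n=A_n^{-1}$,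 means that: (H1) $\varphi$ is the characteristic function of a probability measure on $\mathbb R^d$ and is integrable; (H2) $\Sigma_n\to 0$, and $\varphi_n(\Sigma_n^*t)\to\varphi(t)$ uniformly for $t$ in compact subsets of $\mathbb R^d$; (H3) for every $k\ge 0$, $$\lim_{a\to+\infty}\ \sup_{n\ge 1}\int_{|t|\ge a}|\varphi_n(\Sigma_n^*t)|\,\mathbf 1_{|\Sigma_n^*t|\le k}\,dt=0.$$ -/

import Mathlib

open MeasureTheory ProbabilityTheory Filter Topology

/-- Mod-`φ` convergence of a sequence `X` of random variables on the probability space `(Ω, P)`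
with values in a finite-dimensional Euclidean space `E`, where `φ = charFun μ` is the
characteristic function of a probability measure `μ` on `E`, with respect to the sequence of
linear automorphisms `A n`, whose inverses `(A n).symm` are the `Σ_n`. -/
structure ModConvergence {Ω E : Type*} [MeasurableSpace Ω]
    [NormedAddCommGroup E] [InnerProductSpace ℝ E] [FiniteDimensional ℝ E] [CompleteSpace E]
    [MeasurableSpace E] [BorelSpace E]
    (P : Measure Ω) (X : ℕ → Ω → E) (A : ℕ → E ≃L[ℝ] E) (μ : ProbabilityMeasure E) : Prop where
  /-- the `X n` are random variables -/
  aemeasurable : ∀ n, AEMeasurable (X n) P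
  /-- (H1) `φ` is integrable -/
  integrable_charFun : Integrable (charFun (μ : Measure E)) volume
  /-- (H2), first part: `Σ_n → 0` -/
  tendsto_symm : Tendsto (fun n => ((A n).symm : E →L[ℝ] E)) atTop (𝓝 0)
  /-- (H2), second part: `φ_n (Σ_n^* t) → φ t`, uniformly on compact sets -/
  tendsto_charFun : ∀ K : Set E, IsCompact K →
    TendstoUniformlyOn
      (fun n t => charFun (P.map (X n)) (ContinuousLinearMap.adjoint ((A n).symm : E →L[ℝ] E) t))
      (charFun (μ : Measure E)) atTop K
  /-- (H3) for every `k`, the functions `φ_n (Σ_n^* t) 1_{|Σ_n^* t| ≤ k}` are uniformly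
  integrable: their integrals over `|t| ≥ a` tend to `0` as `a → ∞`, uniformly in `n` -/
  tendsto_tail : ∀ k : ℝ, 0 ≤ k →
    Tendsto (fun a : ℝ => ⨆ n : ℕ,
      ∫⁻ t in {t : E | a ≤ ‖t‖ ∧ ‖ContinuousLinearMap.adjoint ((A n).symm : E →L[ℝ] E) t‖ ≤ k},
        ‖charFun (P.map (X n)) (ContinuousLinearMap.adjoint ((A n).symm : E →L[ℝ] E) t)‖ₑ)
      atTop (𝓝 0)

/-- The function `φ(t) = exp (-4 ∫_0^1 sin² (t v / 2) dv / v)`. -/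
noncomputable def sqfPhi (t : ℝ) : ℝ :=
  Real.exp (-4 * ∫ v in (0 : ℝ)..1, Real.sin (t * v / 2) ^ 2 / v)

/-- The sequence of primes, counted from `0`: `primeSeq 0 = 2`, `primeSeq 1 = 3`, .... -/
noncomputable def primeSeq (n : ℕ) : ℕ := Nat.nth Nat.Prime n

/-- The family `η` of random variables, indexed by the primes, is independent, and each `η p`
takes the values `1`, `-1`, `0` with probabilities `p / (p + 1)²`, `p / (p + 1)²`,
`(p² + 1) / (p + 1)²`. -/
structure IsSquarefreeModel {Ω : Type*} [MeasurableSpace Ω] (P : Measure Ω)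
    (η : Nat.Primes → Ω → ℝ) : Prop where
  measurable : ∀ p, Measurable (η p)
  indep : iIndepFun η P
  prob_one : ∀ p : Nat.Primes,
    P {ω | η p ω = 1} = ENNReal.ofReal ((p : ℝ) / ((p : ℝ) + 1) ^ 2)
  prob_neg_one : ∀ p : Nat.Primes,
    P {ω | η p ω = -1} = ENNReal.ofReal ((p : ℝ) / ((p : ℝ) + 1) ^ 2)
  prob_zero : ∀ p : Nat.Primes,
    P {ω | η p ω = 0} = ENNReal.ofReal (((p : ℝ) ^ 2 + 1) / ((p : ℝ) + 1) ^ 2)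

/-- `X_n = ∑_{p ≤ p_n} η_p log p`, a sum over primes. -/
noncomputable def sqfSum {Ω : Type*} (η : Nat.Primes → Ω → ℝ) (n : ℕ) (ω : Ω) : ℝ :=
  ∑ p ∈ (Finset.Iic (primeSeq n)).subtype Nat.Prime, η p ω * Real.log (p : ℕ)

/-! By independence, the characteristic function of `X_n` is the product over `p ≤ p_n` of `1 -
4p/(p+1)² sin²(s log p / 2)` (`sqfProd`), and everything reduces to two estimates of it, with `N =
p_n` and `s = t / log N`.

For `t` in a compact set, the product is close to `exp(-4 ∑ sin²(t log p / (2 log N)) / p)`. By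
Mertens' first theorem the weights `log p / (p log N)` at the points `log p / log N` approximate
Lebesgue measure on `[0, 1]`, so the exponent tends to that of `φ`. The error `O((1 + t²) / log N)`
(`exists_abs_sqfProd_sub_sqfPhi_le`) gives (H2), and Lévy's continuity theorem then yields `μ`.

For `|s| ≤ k` but `t` unbounded this error is useless, and decay comes from zeta. Comparing `log
|ζ(1+σ)|` with `log |ζ(1+σ+is)|` at `σ = 1 / log N`, the simple pole at `1` gives `∑_{p ≤ N} (1 -
cos(s log p)) / p ≥ log(|s| log N) - O_k(1)`. The exponent contains twice this sum, so the product
is at most `C_k / (s log N)² = C_k / t²` (`exists_sqfProd_le`). Letting `n → ∞` gives the decay and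
integrability of `φ`; the same majorant, independent of `n`, gives (H3). -/

/-! ### Zeta near the line `Re z = 1` and cosine sums over primes -/

theorem continuous_update_sub_one_mul_riemannZeta :
    Continuous (Function.update (fun z : ℂ => (z - 1) * riemannZeta z) 1 1) := by
  refine continuous_iff_continuousAt.2 fun z => ?_
  by_cases hz : z = 1
  · subst hz
    exact continuousAt_update_same.2 riemannZeta_residue_one
  · refine (continuousAt_update_of_ne hz).2 ?_
    exact ((continuousAt_id.sub continuousAt_const).mul
      (differentiableAt_riemannZeta hz).continuousAt)

/-- Compactness: once its singularity at `1` is removed, `(z - 1) ζ(z)` is continuous, and it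
vanishes nowhere on `Re z ≥ 1`. Below, `b` is used only at `s = 0`, where it expresses the pole. -/
theorem exists_norm_sub_one_mul_riemannZeta_bounds (k : ℝ) :
    ∃ b B : ℝ, 0 < b ∧ 0 < B ∧ ∀ σ s : ℝ, 0 < σ → σ ≤ 2 → |s| ≤ k →
      b ≤ ‖(σ + s * Complex.I : ℂ)‖ * ‖riemannZeta (1 + σ + s * Complex.I)‖ ∧
      ‖(σ + s * Complex.I : ℂ)‖ * ‖riemannZeta (1 + σ + s * Complex.I)‖ ≤ B := by
  set H : ℂ → ℂ := Function.update (fun z : ℂ => (z - 1) * riemannZeta z) 1 1 with hH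
  have hc : Continuous fun x : ℝ × ℝ => ‖H (1 + x.1 + x.2 * Complex.I)‖ := by
    refine (continuous_update_sub_one_mul_riemannZeta.comp ?_).norm
    fun_prop
  have hK : IsCompact (Set.Icc (0 : ℝ) 2 ×ˢ Set.Icc (-k) k) := isCompact_Icc.prod isCompact_Icc
  by_cases hk : 0 ≤ k
  swap
  · exact ⟨1, 1, one_pos, one_pos, fun σ s _ _ hs => absurd ((abs_nonneg s).trans hs) hk⟩
  have hne : (Set.Icc (0 : ℝ) 2 ×ˢ Set.Icc (-k) k).Nonempty :=
    ⟨(0, 0), ⟨by simp, by simpa using hk⟩⟩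
  obtain ⟨x, hx, hmin⟩ := hK.exists_isMinOn hne hc.continuousOn
  obtain ⟨y, hy, hmax⟩ := hK.exists_isMaxOn hne hc.continuousOn
  have hpos : ∀ z ∈ Set.Icc (0 : ℝ) 2 ×ˢ Set.Icc (-k) k,
      0 < ‖H (1 + z.1 + z.2 * Complex.I)‖ := by
    intro z hz
    rw [norm_pos_iff, hH]
    by_cases h1 : (1 + z.1 + z.2 * Complex.I : ℂ) = 1
    · rw [h1]; simp
    · rw [Function.update_of_ne h1]
      refine mul_ne_zero (sub_ne_zero.2 h1) (riemannZeta_ne_zero_of_one_le_re ?_)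
      simpa using hz.1.1
  refine ⟨_, _, hpos x hx, hpos y hy, fun σ s h0 h2 hs => ?_⟩
  have hmem : (σ, s) ∈ Set.Icc (0 : ℝ) 2 ×ˢ Set.Icc (-k) k := ⟨⟨h0.le, h2⟩, abs_le.1 hs⟩
  have hval : ‖H (1 + σ + s * Complex.I)‖ =
      ‖(σ + s * Complex.I : ℂ)‖ * ‖riemannZeta (1 + σ + s * Complex.I)‖ := by
    have h1 : (1 + σ + s * Complex.I : ℂ) ≠ 1 := by
      intro h
      have := congrArg Complex.re h
      simp at this
      exact h0.ne' this
    rw [hH, Function.update_of_ne h1, norm_mul]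
    congr 2
    ring
  rw [← hval]
  exact ⟨hmin hmem, hmax hmem⟩

theorem summable_primes_rpow_neg {σ : ℝ} (hσ : 0 < σ) :
    Summable fun p : Nat.Primes => (p : ℝ) ^ (-(1 + σ)) :=
  Nat.Primes.summable_rpow.2 (by linarith)

theorem re_natCast_cpow {p : ℕ} (hp : 0 < p) (x s : ℝ) :
    ((p : ℂ) ^ (-(x + s * Complex.I) : ℂ)).re = (p : ℝ) ^ (-x) * Real.cos (s * Real.log p) := by
  rw [Complex.cpow_def_of_ne_zero (by exact_mod_cast hp.ne'), ← Complex.natCast_log]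
  have h : (Real.log p : ℂ) * (-(x + s * Complex.I)) =
      ((Real.log p * -x : ℝ) : ℂ) + ((-(s * Real.log p) : ℝ) : ℂ) * Complex.I := by
    push_cast; ring
  rw [h, Real.rpow_def_of_pos (show (0 : ℝ) < p by exact_mod_cast hp)]
  generalize Real.log p = l
  rw [Complex.exp_re]
  simp

theorem summable_rpow_mul_cos {σ : ℝ} (hσ : 0 < σ) (s : ℝ) :
    Summable fun p : Nat.Primes => (p : ℝ) ^ (-(1 + σ)) * Real.cos (s * Real.log p) := by
  refine (summable_primes_rpow_neg hσ).of_norm_bounded fun p => ?_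
  rw [norm_mul, Real.norm_of_nonneg (by positivity)]
  exact mul_le_of_le_one_right (by positivity) (Real.abs_cos_le_one _)

/-- Take the real part of the logarithm of the Euler product. With `w = p^(-z)` and `|w| ≤ 1/2`, the
terms of order at least two in `-log(1 - w)` total at most `|w|² ≤ p⁻²`, uniformly in `σ` and `s`.
-/
theorem abs_log_norm_riemannZeta_sub_tsum_le {σ : ℝ} (hσ : 0 < σ) (s : ℝ) :
    |Real.log ‖riemannZeta (1 + σ + s * Complex.I)‖ -
      ∑' p : Nat.Primes, (p : ℝ) ^ (-(1 + σ)) * Real.cos (s * Real.log p)| ≤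
    ∑' p : Nat.Primes, (p : ℝ) ^ (-2 : ℝ) := by
  have hs2 : Summable fun p : Nat.Primes => (p : ℝ) ^ (-2 : ℝ) :=
    Nat.Primes.summable_rpow.2 (by norm_num)
  set z : ℂ := 1 + σ + s * Complex.I with hz
  have hre : 1 < z.re := by simp [hz, hσ]
  have hnorm : ∀ p : Nat.Primes, ‖(p : ℂ) ^ (-z)‖ = (p : ℝ) ^ (-(1 + σ)) := by
    intro p
    rw [Complex.norm_natCast_cpow_of_pos p.2.pos]
    simp [hz]
  have hle : ∀ p : Nat.Primes, (p : ℝ) ^ (-(1 + σ)) ≤ 1 / 2 := by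
    intro p
    have h2 : (2 : ℝ) ≤ p := by exact_mod_cast p.2.two_le
    calc (p : ℝ) ^ (-(1 + σ)) ≤ (p : ℝ) ^ (-1 : ℝ) :=
          Real.rpow_le_rpow_of_exponent_le (by linarith) (by linarith)
      _ = (p : ℝ)⁻¹ := Real.rpow_neg_one _
      _ ≤ 1 / 2 := by rw [one_div]; exact inv_anti₀ two_pos h2
  have hterm : ∀ p : Nat.Primes,
      ‖(-Complex.log (1 - (p : ℂ) ^ (-z))).re -
        (p : ℝ) ^ (-(1 + σ)) * Real.cos (s * Real.log p)‖ ≤ (p : ℝ) ^ (-2 : ℝ) := by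
    intro p
    have h2 : (2 : ℝ) ≤ p := by exact_mod_cast p.2.two_le
    have hre' : (p : ℝ) ^ (-(1 + σ)) * Real.cos (s * Real.log p) = ((p : ℂ) ^ (-z)).re := by
      rw [← re_natCast_cpow p.2.pos, hz]
      push_cast
      rfl
    rw [hre', ← Complex.sub_re]
    refine (Complex.abs_re_le_norm _).trans ?_
    have hlt : ‖(p : ℂ) ^ (-z)‖ ≤ 1 / 2 := (hnorm p).trans_le (hle p)
    have h := Complex.norm_log_one_add_sub_self_le (z := -(p : ℂ) ^ (-z))
      (by rw [norm_neg]; linarith)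
    rw [norm_neg] at h
    have hinv : (1 - ‖(p : ℂ) ^ (-z)‖)⁻¹ ≤ 2 := by
      rw [inv_le_comm₀ (by linarith) two_pos]; linarith
    calc ‖-Complex.log (1 - (p : ℂ) ^ (-z)) - (p : ℂ) ^ (-z)‖
        = ‖Complex.log (1 + -(p : ℂ) ^ (-z)) - -(p : ℂ) ^ (-z)‖ := by
          rw [← norm_neg]; congr 1; ring_nf
      _ ≤ ‖(p : ℂ) ^ (-z)‖ ^ 2 * (1 - ‖(p : ℂ) ^ (-z)‖)⁻¹ / 2 := h
      _ ≤ ‖(p : ℂ) ^ (-z)‖ ^ 2 * 2 / 2 := by gcongr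
      _ = ((p : ℝ) ^ (-(1 + σ))) ^ 2 := by rw [hnorm]; ring
      _ ≤ ((p : ℝ) ^ (-1 : ℝ)) ^ 2 := by
          gcongr
          · linarith
          · linarith
      _ = (p : ℝ) ^ (-2 : ℝ) := by
          rw [← Real.rpow_natCast, ← Real.rpow_mul (by positivity)]; norm_num
  have hcos := summable_rpow_mul_cos hσ s
  have hdiff := hs2.of_norm_bounded hterm
  have hlogre : Summable fun p : Nat.Primes => (-Complex.log (1 - (p : ℂ) ^ (-z))).re := by
    simpa using hdiff.add hcos
  have hlog : Summable fun p : Nat.Primes => -Complex.log (1 - (p : ℂ) ^ (-z)) := by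
    have := DirichletCharacter.summable_neg_log_one_sub_mul_prime_cpow
      (1 : DirichletCharacter ℂ 1) hre
    refine this.congr fun p => ?_
    rw [show (1 : DirichletCharacter ℂ 1) (p : ℕ) = 1 by
      rw [MulChar.one_apply]; exact isUnit_of_subsingleton _, one_mul]
  have hzeta : Real.log ‖riemannZeta z‖ =
      ∑' p : Nat.Primes, (-Complex.log (1 - (p : ℂ) ^ (-z))).re := by
    rw [← riemannZeta_eulerProduct_exp_log hre, Complex.norm_exp, Real.log_exp,
      Complex.re_tsum hlog]
  rw [hzeta, ← hlogre.tsum_sub hcos]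
  exact tsum_of_norm_bounded hs2.hasSum hterm

/-- The sum is `log |ζ(1+σ)| - log |ζ(1+σ+is)|` up to a constant. The first term is at least `-log σ
- O(1)`, the second at most `-log |s| + O(1)`, because `|σ + is| ≥ |s|`. -/
theorem exists_log_div_sub_le_tsum_one_sub_cos (k : ℝ) :
    ∃ C : ℝ, ∀ σ s : ℝ, 0 < σ → σ ≤ 2 → |s| ≤ k → s ≠ 0 →
      Real.log (|s| / σ) - C ≤
        ∑' p : Nat.Primes, (p : ℝ) ^ (-(1 + σ)) * (1 - Real.cos (s * Real.log p)) := by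
  obtain ⟨b, B, hb, hB, h⟩ := exists_norm_sub_one_mul_riemannZeta_bounds k
  set K := ∑' p : Nat.Primes, (p : ℝ) ^ (-2 : ℝ)
  refine ⟨Real.log B - Real.log b + 2 * K, fun σ s h0 h2 hs hs0 => ?_⟩
  have hk : 0 ≤ k := (abs_nonneg _).trans hs
  have e1 := abs_le.1 (abs_log_norm_riemannZeta_sub_tsum_le h0 s)
  have e0 := abs_le.1 (abs_log_norm_riemannZeta_sub_tsum_le h0 0)
  have z0 := (h σ 0 h0 h2 (by simpa using hk)).1
  have z1 := (h σ s h0 h2 hs).2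
  simp only [Complex.ofReal_zero, zero_mul, add_zero, Real.cos_zero, mul_one] at e0 z0
  rw [Complex.norm_real, Real.norm_of_nonneg h0.le] at z0
  have hsplit : ∑' p : Nat.Primes, (p : ℝ) ^ (-(1 + σ)) * (1 - Real.cos (s * Real.log p)) =
      ∑' p : Nat.Primes, (p : ℝ) ^ (-(1 + σ)) -
      ∑' p : Nat.Primes, (p : ℝ) ^ (-(1 + σ)) * Real.cos (s * Real.log p) := by
    rw [← (summable_primes_rpow_neg h0).tsum_sub (summable_rpow_mul_cos h0 s)]
    exact tsum_congr fun p => by ring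
  have hspos : 0 < |s| := abs_pos.2 hs0
  have hs' : |s| ≤ ‖(σ + s * Complex.I : ℂ)‖ := by
    simpa using Complex.abs_im_le_norm (σ + s * Complex.I : ℂ)
  have hzpos : 0 < ‖riemannZeta (1 + σ + s * Complex.I)‖ :=
    norm_pos_iff.2 (riemannZeta_ne_zero_of_one_le_re (by simp [h0.le]))
  have hzpos0 : 0 < ‖riemannZeta (1 + σ)‖ :=
    norm_pos_iff.2 (riemannZeta_ne_zero_of_one_le_re (by simp [h0.le]))
  have l0 := Real.log_le_log hb z0
  rw [Real.log_mul h0.ne' hzpos0.ne'] at l0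
  have l1 := Real.log_le_log (by positivity)
    ((mul_le_mul_of_nonneg_right hs' hzpos.le).trans z1)
  rw [Real.log_mul hspos.ne' hzpos.ne'] at l1
  rw [hsplit, Real.log_div hspos.ne' h0.ne']
  linarith [e1.2, e0.1]

/-- Up to a constant this is `log(ζ(1+σ/2) / ζ(1+σ))`, and the pole makes the ratio bounded. It
serves to control the tail `p > N` when the full prime sum is truncated. -/
theorem exists_tsum_rpow_sub_rpow_le :
    ∃ C : ℝ, ∀ σ : ℝ, 0 < σ → σ ≤ 2 →
      ∑' p : Nat.Primes, ((p : ℝ) ^ (-(1 + σ / 2)) - (p : ℝ) ^ (-(1 + σ))) ≤ C := by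
  obtain ⟨b, B, hb, hB, h⟩ := exists_norm_sub_one_mul_riemannZeta_bounds 0
  set K := ∑' p : Nat.Primes, (p : ℝ) ^ (-2 : ℝ)
  refine ⟨Real.log B - Real.log b + 2 * K + Real.log 2, fun σ h0 h2 => ?_⟩
  have h0' : 0 < σ / 2 := by positivity
  have e1 := abs_le.1 (abs_log_norm_riemannZeta_sub_tsum_le h0' 0)
  have e0 := abs_le.1 (abs_log_norm_riemannZeta_sub_tsum_le h0 0)
  have z0 := (h σ 0 h0 h2 (by simp)).1
  have z1 := (h (σ / 2) 0 h0' (by linarith) (by simp)).2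
  simp only [Complex.ofReal_zero, zero_mul, add_zero, Real.cos_zero, mul_one] at e0 z0 e1 z1
  rw [Complex.norm_real, Real.norm_of_nonneg h0.le] at z0
  rw [Complex.norm_real, Real.norm_of_nonneg h0'.le] at z1
  have hzpos : 0 < ‖riemannZeta (1 + (σ / 2 : ℝ))‖ :=
    norm_pos_iff.2 (riemannZeta_ne_zero_of_one_le_re (by simpa using h0'.le))
  have hzpos0 : 0 < ‖riemannZeta (1 + σ)‖ :=
    norm_pos_iff.2 (riemannZeta_ne_zero_of_one_le_re (by simp [h0.le]))
  have l0 := Real.log_le_log hb z0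
  rw [Real.log_mul h0.ne' hzpos0.ne'] at l0
  have l1 := Real.log_le_log (by positivity) z1
  rw [Real.log_mul h0'.ne' hzpos.ne', Real.log_div h0.ne' two_ne_zero] at l1
  rw [(summable_primes_rpow_neg h0').tsum_sub (summable_primes_rpow_neg h0)]
  linarith [e1.1, e0.2]

/-- The weighted sum `∑_{p ≤ N} (1 - cos (s log p)) / p` is at least `log (|s| log N) - O(1)`,
uniformly for bounded `s`. -/
theorem exists_log_mul_log_sub_le_sum_one_sub_cos (k : ℝ) :
    ∃ C : ℝ, ∀ (N : ℕ) (s : ℝ), 2 ≤ N → |s| ≤ k → s ≠ 0 →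
      Real.log (|s| * Real.log N) - C ≤
        ∑ p ∈ (Finset.Iic N).subtype Nat.Prime,
          (1 - Real.cos (s * Real.log (p : ℕ))) / (p : ℕ) := by
  obtain ⟨C₁, h₁⟩ := exists_log_div_sub_le_tsum_one_sub_cos k
  obtain ⟨C₂, h₂⟩ := exists_tsum_rpow_sub_rpow_le
  refine ⟨C₁ + 6 * C₂, fun N s hN hs hs0 => ?_⟩
  have hN2 : (2 : ℝ) ≤ N := by exact_mod_cast hN
  have hlog2 : 1 / 2 ≤ Real.log 2 := by linarith [Real.log_two_gt_d9]
  have hlogN : Real.log 2 ≤ Real.log N := Real.log_le_log two_pos hN2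
  have hL : 0 < Real.log N := by linarith
  set σ := (Real.log N)⁻¹ with hσ
  have h0 : 0 < σ := inv_pos.2 hL
  have h2 : σ ≤ 2 := by rw [hσ, inv_le_comm₀ hL two_pos]; linarith
  have g₁ := h₁ σ s h0 h2 hs hs0
  have g₂ := h₂ σ h0 h2
  rw [show |s| / σ = |s| * Real.log N by rw [hσ, div_inv_eq_mul]] at g₁
  set f : Nat.Primes → ℝ := fun p => (p : ℝ) ^ (-(1 + σ)) * (1 - Real.cos (s * Real.log p))
    with hf
  set d : Nat.Primes → ℝ := fun p => (p : ℝ) ^ (-(1 + σ / 2)) - (p : ℝ) ^ (-(1 + σ)) with hd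
  have hfs : Summable f :=
    ((summable_primes_rpow_neg h0).sub (summable_rpow_mul_cos h0 s)).congr
      fun p => by simp only [hf]; ring
  have hds : Summable d := (summable_primes_rpow_neg (by positivity)).sub
    (summable_primes_rpow_neg h0)
  have hp1 : ∀ p : Nat.Primes, (1 : ℝ) < p := fun p => by exact_mod_cast p.2.one_lt
  have hd0 : ∀ p, 0 ≤ d p := fun p => sub_nonneg.2
    (Real.rpow_le_rpow_of_exponent_le (hp1 p).le (by linarith))
  -- Beyond `N`, `σ log p ≥ 1` gives `p^(σ/2) ≥ 3/2`, so `d p ≥ p^(-(1+σ)) / 2`, while `f p ≤ 2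
  -- p^(-(1+σ))`. The factor 4 would already do. Hence the tail of `f` is dominated by `6 d`, whose
  -- total is bounded.
  have hout : ∀ p ∉ (Finset.Iic N).subtype Nat.Prime, 0 ≤ 6 * d p - f p := by
    intro p hp
    have hNp : N < (p : ℕ) := by simpa using hp
    have hlogp : 1 ≤ σ * Real.log p := by
      rw [hσ, ← div_eq_inv_mul, one_le_div hL]
      exact Real.log_le_log (by linarith) (by exact_mod_cast hNp.le)
    have hpos : 0 < (p : ℝ) ^ (-(1 + σ)) := Real.rpow_pos_of_pos (by linarith [hp1 p]) _
    have hfac : (p : ℝ) ^ (-(1 + σ / 2)) = (p : ℝ) ^ (-(1 + σ)) * (p : ℝ) ^ (σ / 2) := by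
      rw [← Real.rpow_add (by linarith [hp1 p])]; congr 1; ring
    have hexp : 3 / 2 ≤ (p : ℝ) ^ (σ / 2) := by
      rw [Real.rpow_def_of_pos (by linarith [hp1 p])]
      have := Real.add_one_le_exp (Real.log p * (σ / 2))
      nlinarith
    have hcos : 1 - Real.cos (s * Real.log p) ≤ 2 := by
      linarith [Real.neg_one_le_cos (s * Real.log p)]
    simp only [hf, hd, hfac]
    nlinarith
  have hsum : ∑ p ∈ (Finset.Iic N).subtype Nat.Prime, (6 * d p - f p) ≤
      ∑' p : Nat.Primes, (6 * d p - f p) :=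
    Summable.sum_le_tsum (ι := Nat.Primes) _ hout ((hds.mul_left 6).sub hfs)
  rw [(hds.mul_left 6).tsum_sub hfs, tsum_mul_left, Finset.sum_sub_distrib, ← Finset.mul_sum]
    at hsum
  have hdS : 0 ≤ ∑ p ∈ (Finset.Iic N).subtype Nat.Prime, d p := Finset.sum_nonneg fun p _ => hd0 p
  have hfS : ∑ p ∈ (Finset.Iic N).subtype Nat.Prime, f p ≤
      ∑ p ∈ (Finset.Iic N).subtype Nat.Prime,
        (1 - Real.cos (s * Real.log (p : ℕ))) / (p : ℕ) := by
    refine Finset.sum_le_sum fun p _ => ?_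
    simp only [hf]
    rw [div_eq_inv_mul]
    refine mul_le_mul_of_nonneg_right ?_ (sub_nonneg.2 (Real.cos_le_one _))
    rw [← Real.rpow_neg_one]
    exact Real.rpow_le_rpow_of_exponent_le (hp1 p).le (by linarith)
  linarith

/-! ### Mertens' first theorem, from the prime factorization of `n!` -/

theorem log_factorial_eq_sum_factorization (n : ℕ) :
    Real.log n.factorial =
      ∑ p ∈ Finset.Icc 0 n with p.Prime, (n.factorial.factorization p : ℝ) * Real.log p := by
  rw [Real.log_nat_eq_sum_factorization, Finsupp.sum_of_support_subset _ _ _ (by simp)]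
  intro p hp
  have hp' : p.Prime ∧ p ∣ n.factorial := by
    rw [Nat.support_factorization, Nat.mem_primeFactors] at hp
    exact ⟨hp.1, hp.2.1⟩
  simpa using ⟨(hp'.1.dvd_factorial).1 hp'.2, hp'.1⟩

theorem cast_div_sub_one_le_factorization_factorial {p : ℕ} (hp : p.Prime) (n : ℕ) :
    (n : ℝ) / p - 1 ≤ n.factorial.factorization p := by
  have h1 : n / p ≤ n.factorial.factorization p := by
    rw [Nat.factorization_factorial hp (b := Nat.log p n + 2) (by omega)]
    have := Finset.single_le_sum (f := fun i => n / p ^ i) (fun i _ => Nat.zero_le _)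
      (Finset.mem_Ico.2 ⟨le_refl 1, show 1 < Nat.log p n + 2 by omega⟩)
    simpa using this
  have h2 : (n : ℝ) / p < (n / p : ℕ) + 1 := by
    rw [← Nat.floor_div_eq_div (K := ℝ)]
    exact Nat.lt_floor_add_one _
  have h3 : ((n / p : ℕ) : ℝ) ≤ n.factorial.factorization p := by exact_mod_cast h1
  linarith

theorem factorization_factorial_le_cast_div {p : ℕ} (hp : p.Prime) (n : ℕ) :
    (n.factorial.factorization p : ℝ) ≤ (n : ℝ) / (p - 1) := by
  have h1 : (p - 1) * n.factorial.factorization p ≤ n := by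
    rw [Nat.sub_one_mul_factorization_factorial hp]
    exact Nat.sub_le _ _
  have h2 : (1 : ℝ) < p := by exact_mod_cast hp.one_lt
  rw [le_div_iff₀ (by linarith)]
  have h3 : (((p - 1) * n.factorial.factorization p : ℕ) : ℝ) ≤ n := by exact_mod_cast h1
  rw [Nat.cast_mul, Nat.cast_sub hp.one_lt.le] at h3
  push_cast at h3
  linarith

/-- This is the price of replacing Legendre's bound `n / (p - 1)` by `n / p`. From `log x ≤ 2 √x`
and `x - 1 ≥ x / 2` it is summable. -/
theorem log_div_mul_sub_one_le {x : ℝ} (hx : 2 ≤ x) :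
    Real.log x / (x - 1) - Real.log x / x ≤ 4 * x ^ (-(3 / 2) : ℝ) := by
  have h0 : 0 < x := by linarith
  have h1 : 0 < x - 1 := by linarith
  have hlog := Real.log_le_rpow_div h0.le (show (0 : ℝ) < 1 / 2 by norm_num)
  have hsplit : x ^ (-(3 / 2) : ℝ) = x ^ (1 / 2 : ℝ) / x ^ 2 := by
    rw [← Real.rpow_natCast, ← Real.rpow_sub h0]; norm_num
  have hpow : 0 < x ^ (1 / 2 : ℝ) := by positivity
  rw [hsplit, div_sub_div _ _ h1.ne' h0.ne', mul_div_assoc', div_le_div_iff₀ (by positivity)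
    (by positivity)]
  have h2 : Real.log x ≤ 2 * x ^ (1 / 2 : ℝ) := by
    linarith [show x ^ (1 / 2 : ℝ) / (1 / 2) = 2 * x ^ (1 / 2 : ℝ) by ring]
  have h3 : 0 ≤ Real.log x := Real.log_nonneg (by linarith)
  calc (Real.log x * x - (x - 1) * Real.log x) * x ^ 2 = Real.log x * x ^ 2 := by ring
    _ ≤ 2 * x ^ (1 / 2 : ℝ) * x ^ 2 := by gcongr
    _ ≤ 4 * x ^ (1 / 2 : ℝ) * ((x - 1) * x) := by
        have h4 : x ^ 2 ≤ 2 * ((x - 1) * x) := by nlinarith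
        linarith [mul_le_mul_of_nonneg_left h4 (mul_nonneg two_pos.le hpow.le)]

/-- Mertens' first theorem at the integers. -/
theorem exists_abs_sum_log_div_sub_log_le_nat :
    ∃ C : ℝ, ∀ n : ℕ, 1 ≤ n →
      |∑ p ∈ Finset.Icc 0 n with p.Prime, Real.log p / p - Real.log n| ≤ C := by
  have hZ : Summable fun n : ℕ => (n : ℝ) ^ (-(3 / 2) : ℝ) :=
    Real.summable_nat_rpow.2 (by norm_num)
  set Z := ∑' n : ℕ, (n : ℝ) ^ (-(3 / 2) : ℝ) with hZdef
  have hZ0 : 0 ≤ Z := tsum_nonneg fun n => by positivity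
  have hlog4 : 0 ≤ Real.log 4 := Real.log_nonneg (by norm_num)
  refine ⟨Real.log 4 + 1 + 4 * Z, fun n hn => ?_⟩
  have hn0 : (0 : ℝ) < n := by exact_mod_cast hn
  set F := ∑ p ∈ Finset.Icc 0 n with p.Prime, Real.log p / p with hF
  have hlogp : ∀ p ∈ (Finset.Icc 0 n).filter Nat.Prime, 0 ≤ Real.log p := fun p _ =>
    Real.log_natCast_nonneg p
  have hprime : ∀ p ∈ (Finset.Icc 0 n).filter Nat.Prime, p.Prime := fun p hp =>
    (Finset.mem_filter.1 hp).2
  have hupper : n * F ≤ Real.log n.factorial + Real.log 4 * n := by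
    -- Using `n / p - 1` as a lower bound for the exponent loses `log p` for each prime, hence `θ(n)
    -- ≤ n log 4` in all.
    have hθ := Chebyshev.theta_le_log4_mul_x hn0.le
    rw [Chebyshev.theta_eq_sum_Icc, Nat.floor_natCast] at hθ
    refine le_trans ?_ (add_le_add_right hθ _)
    rw [log_factorial_eq_sum_factorization, hF, Finset.mul_sum, ← Finset.sum_add_distrib]
    refine Finset.sum_le_sum fun p hp => ?_
    have h := mul_le_mul_of_nonneg_right
      (cast_div_sub_one_le_factorization_factorial (hprime p hp) n) (hlogp p hp)
    linarith [show (n : ℝ) * (Real.log p / p) = (n / p) * Real.log p by ring]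
  have hlower : Real.log n.factorial ≤ n * F + n * (4 * Z) := by
    have hsum : ∑ p ∈ Finset.Icc 0 n with p.Prime, (p : ℝ) ^ (-(3 / 2) : ℝ) ≤ Z :=
      hZ.sum_le_tsum _ fun n _ => by positivity
    have hn4 := mul_le_mul_of_nonneg_left (mul_le_mul_of_nonneg_left hsum zero_le_four) hn0.le
    refine le_trans ?_ (add_le_add_right hn4 _)
    rw [log_factorial_eq_sum_factorization, hF, Finset.mul_sum, Finset.mul_sum, Finset.mul_sum,
      ← Finset.sum_add_distrib]
    refine Finset.sum_le_sum fun p hp => ?_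
    have h := mul_le_mul_of_nonneg_right
      (factorization_factorial_le_cast_div (hprime p hp) n) (hlogp p hp)
    have h' := mul_le_mul_of_nonneg_left (log_div_mul_sub_one_le
      (show (2 : ℝ) ≤ p by exact_mod_cast (hprime p hp).two_le)) hn0.le
    linarith [show (n : ℝ) * (Real.log p / (p - 1) - Real.log p / p) =
      n / (p - 1) * Real.log p - n * (Real.log p / p) by ring]
  have hfac_le : Real.log n.factorial ≤ n * Real.log n := by
    rw [← Real.log_pow]
    exact Real.log_le_log (by exact_mod_cast n.factorial_pos) (by exact_mod_cast n.factorial_le_pow)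
  have hfac_ge : n * Real.log n - n ≤ Real.log n.factorial := by
    have h := Stirling.le_log_factorial_stirling (n := n) (by omega)
    have h1 := Real.log_natCast_nonneg n
    have h2 : 0 ≤ Real.log (2 * Real.pi) := Real.log_nonneg (by linarith [Real.pi_gt_three])
    linarith
  rw [abs_le]
  constructor
  · refine le_of_mul_le_mul_left ?_ hn0
    nlinarith
  · refine le_of_mul_le_mul_left ?_ hn0
    nlinarith

/-- Mertens' first theorem. -/
theorem exists_abs_sum_log_div_sub_log_le :
    ∃ C : ℝ, 0 ≤ C ∧ ∀ x : ℝ, 1 ≤ x →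
      |∑ k ∈ Finset.Icc 0 ⌊x⌋₊, (if k.Prime then Real.log k / k else 0) - Real.log x| ≤ C := by
  obtain ⟨C, hC⟩ := exists_abs_sum_log_div_sub_log_le_nat
  have hlog2 : 0 ≤ Real.log 2 := Real.log_nonneg one_le_two
  refine ⟨C + Real.log 2, add_nonneg ((abs_nonneg _).trans (hC 1 le_rfl)) hlog2, fun x hx => ?_⟩
  have hn : 1 ≤ ⌊x⌋₊ := (Nat.one_le_floor_iff _).2 hx
  have hn' : (1 : ℝ) ≤ ⌊x⌋₊ := by exact_mod_cast hn
  have h := hC _ hn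
  rw [Finset.sum_filter] at h
  have hfl : (⌊x⌋₊ : ℝ) ≤ x := Nat.floor_le (by linarith)
  have h1 : Real.log ⌊x⌋₊ ≤ Real.log x := Real.log_le_log (by linarith) hfl
  -- Since `⌊x⌋ ≥ 1`, `x ≤ 2 ⌊x⌋`: passing from integers to reals costs `log 2`.
  have h2 : Real.log x ≤ Real.log 2 + Real.log ⌊x⌋₊ := by
    rw [← Real.log_mul two_ne_zero (by linarith)]
    exact Real.log_le_log (by linarith) (by linarith [Nat.lt_floor_add_one x])
  rw [abs_le] at h ⊢
  constructor <;> linarith [h.1, h.2]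

/-! ### Partial summation and Riemann–Stieltjes sums over primes -/

/-- Abel summation replaces the weights `log p / p` by `d(log x) = dx / x`. Mertens bounds the
discrepancy of the summatory functions by `C`, and `|f'| ≤ M / x` makes its integral against `f'` at
most `C M log N`. Starting at `2` leaves the boundary term `f(2) log 2`. -/
theorem exists_abs_sum_mul_sub_integral_div_le :
    ∃ C : ℝ, 0 ≤ C ∧ ∀ (N : ℕ) (f f' : ℝ → ℝ) (M : ℝ), 2 ≤ N →
      (∀ x ∈ Set.Icc (2 : ℝ) N, HasDerivAt f (f' x) x) →
      ContinuousOn f' (Set.Icc (2 : ℝ) N) →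
      (∀ x ∈ Set.Icc (2 : ℝ) N, |f' x| ≤ M / x) →
      |∑ k ∈ Finset.Icc 0 N, f k * (if k.Prime then Real.log k / k else 0) -
        ∫ x in (2 : ℝ)..N, f x / x| ≤ C * (|f N| + M * Real.log N) + |f 2| * Real.log 2 := by
  obtain ⟨C, hC0, hC⟩ := exists_abs_sum_log_div_sub_log_le
  refine ⟨C, hC0, fun N f f' M hN hf hf' hM => ?_⟩
  have hN2 : (2 : ℝ) ≤ N := by exact_mod_cast hN
  have hlog2 : 0 ≤ Real.log 2 := Real.log_nonneg one_le_two
  have huIcc : Set.uIcc (2 : ℝ) N = Set.Icc (2 : ℝ) N := Set.uIcc_of_le hN2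
  set c : ℕ → ℝ := fun k => if k.Prime then Real.log k / k else 0 with hc
  set F : ℝ → ℝ := fun x => ∑ k ∈ Finset.Icc 0 ⌊x⌋₊, c k with hF
  have hc0 : ∀ k, 0 ≤ c k := fun k => by
    simp only [hc]
    split_ifs
    · exact div_nonneg (Real.log_natCast_nonneg k) k.cast_nonneg
    · exact le_rfl
  have hmono : Monotone F := fun x y hxy =>
    Finset.sum_le_sum_of_subset_of_nonneg
      (Finset.Icc_subset_Icc le_rfl (Nat.floor_le_floor hxy)) fun k _ _ => hc0 k
  have hlogc : ContinuousOn Real.log (Set.Icc (2 : ℝ) N) := fun x hx =>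
    (Real.continuousAt_log (by linarith [hx.1])).continuousWithinAt
  have hFi : IntervalIntegrable (fun x => f' x * F x) volume 2 N :=
    (hmono.monotoneOn _).intervalIntegrable.continuousOn_mul (huIcc ▸ hf')
  have hLi : IntervalIntegrable (fun x => f' x * Real.log x) volume 2 N :=
    (ContinuousOn.mul (huIcc ▸ hf') (huIcc ▸ hlogc)).intervalIntegrable
  have hderiv : Set.EqOn (deriv f) f' (Set.Icc (2 : ℝ) N) := fun x hx => (hf x hx).deriv
  have habel : ∑ k ∈ Finset.Icc 0 N, f k * c k = f N * F N - ∫ x in (2 : ℝ)..N, f' x * F x := by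
    -- The weights vanish at `0` and `1`, which allows Abel summation to start at `2`, away from the
    -- zero of `log`.
    have h := sum_mul_eq_sub_integral_mul₁ c (f := f) (by simp [hc]) (by simp [hc, Nat.not_prime_one])
      (N : ℝ) (fun x hx => (hf x hx).differentiableAt)
      ((hf'.integrableOn_Icc).congr_fun hderiv.symm measurableSet_Icc)
    rw [Nat.floor_natCast] at h
    rw [h, intervalIntegral.integral_of_le hN2]
    congr 1
    · simp [hF]
    · exact setIntegral_congr_fun measurableSet_Ioc fun x hx => by
        simp only [hF, hderiv (Set.Ioc_subset_Icc_self hx)]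
  have hparts : ∫ x in (2 : ℝ)..N, f' x * Real.log x =
      f N * Real.log N - f 2 * Real.log 2 - ∫ x in (2 : ℝ)..N, f x / x := by
    have h := intervalIntegral.integral_mul_deriv_eq_deriv_mul (a := (2 : ℝ)) (b := N)
      (u := f) (v := Real.log) (u' := f') (v' := fun x => x⁻¹)
      (fun x hx => hf x (huIcc ▸ hx))
      (fun x hx => Real.hasDerivAt_log (by rw [huIcc] at hx; linarith [hx.1]))
      (huIcc ▸ hf' : ContinuousOn f' (Set.uIcc 2 (N : ℝ))).intervalIntegrable
      (ContinuousOn.intervalIntegrable fun x hx => (continuousAt_inv₀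
        (by rw [huIcc] at hx; linarith [hx.1])).continuousWithinAt)
    simp only [div_eq_mul_inv]
    linarith
  have hident : ∑ k ∈ Finset.Icc 0 N, f k * c k - ∫ x in (2 : ℝ)..N, f x / x =
      f N * (F N - Real.log N) - (∫ x in (2 : ℝ)..N, f' x * (F x - Real.log x)) +
        f 2 * Real.log 2 := by
    have : ∫ x in (2 : ℝ)..N, f' x * (F x - Real.log x) =
        (∫ x in (2 : ℝ)..N, f' x * F x) - ∫ x in (2 : ℝ)..N, f' x * Real.log x := by
      rw [← intervalIntegral.integral_sub hFi hLi]
      exact intervalIntegral.integral_congr fun x _ => by ring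
    rw [habel, this, hparts]
    ring
  have hbound : ‖∫ x in (2 : ℝ)..N, f' x * (F x - Real.log x)‖ ≤ C * (M * Real.log N) := by
    have hM0 : 0 ≤ M := by
      have h := (abs_nonneg _).trans (hM 2 ⟨le_rfl, hN2⟩)
      linarith
    calc ‖∫ x in (2 : ℝ)..N, f' x * (F x - Real.log x)‖
        ≤ ∫ x in (2 : ℝ)..N, C * M * x⁻¹ := by
          refine intervalIntegral.norm_integral_le_of_norm_le hN2 ?_ ?_
          · refine Eventually.of_forall fun x hx => ?_
            have hx' := Set.Ioc_subset_Icc_self hx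
            have hx0 : 0 < x := by linarith [hx'.1]
            rw [norm_mul, Real.norm_eq_abs, Real.norm_eq_abs]
            calc |f' x| * |F x - Real.log x| ≤ (M / x) * C :=
                  mul_le_mul (hM x hx') (hC x (by linarith [hx'.1])) (abs_nonneg _) (by positivity)
              _ = C * M * x⁻¹ := by ring
          · refine ContinuousOn.intervalIntegrable fun x hx => ?_
            rw [huIcc] at hx
            exact (continuousAt_const.mul
              (continuousAt_inv₀ (by linarith [hx.1]))).continuousWithinAt
      _ = C * M * (Real.log N - Real.log 2) := by
          rw [intervalIntegral.integral_const_mul, integral_inv_of_pos two_pos (by linarith),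
            Real.log_div (by linarith) two_ne_zero]
      _ ≤ C * (M * Real.log N) := by
          rw [← mul_assoc]
          exact mul_le_mul_of_nonneg_left (by linarith) (by positivity)
  rw [hident]
  calc _ ≤ |f N * (F N - Real.log N)| + |∫ x in (2 : ℝ)..N, f' x * (F x - Real.log x)| +
        |f 2 * Real.log 2| := (abs_add_le _ _).trans (add_le_add_left (abs_sub _ _) _)
    _ ≤ |f N| * C + C * (M * Real.log N) + |f 2| * Real.log 2 := by
        rw [abs_mul, abs_mul, abs_of_nonneg hlog2]
        gcongr
        · exact hC N (by linarith)
        · exact hbound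
    _ = _ := by ring

theorem sin_sq_le_sq (x : ℝ) : Real.sin x ^ 2 ≤ x ^ 2 :=
  sq_le_sq.2 Real.abs_sin_le_abs

theorem sin_sq_div_le (t : ℝ) {v : ℝ} (hv : 0 ≤ v) : Real.sin (t * v / 2) ^ 2 / v ≤ t ^ 2 / 4 * v := by
  rcases hv.eq_or_lt with rfl | hv
  · simp
  · rw [div_le_iff₀ hv]
    calc _ ≤ (t * v / 2) ^ 2 := sin_sq_le_sq _
      _ = _ := by ring

theorem intervalIntegrable_sin_sq_div (t : ℝ) {a b : ℝ} (ha : 0 ≤ a) (hab : a ≤ b) :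
    IntervalIntegrable (fun v => Real.sin (t * v / 2) ^ 2 / v) volume a b := by
  rw [intervalIntegrable_iff_integrableOn_Ioc_of_le hab]
  refine Measure.integrableOn_of_bounded (M := t ^ 2 / 4 * b) (by simp) ?_ ?_
  · exact Measurable.aestronglyMeasurable (by fun_prop)
  · refine (ae_restrict_iff' measurableSet_Ioc).2 (Eventually.of_forall fun v hv => ?_)
    have hv0 : 0 ≤ v := ha.trans hv.1.le
    rw [Real.norm_of_nonneg (by positivity)]
    exact (sin_sq_div_le t hv0).trans (mul_le_mul_of_nonneg_left hv.2 (by positivity))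

/-- Dividing by `log x` is what turns the Mertens weight `log p / p` back into `1 / p`. -/
theorem hasDerivAt_sin_sq_log_div_log (α : ℝ) {x : ℝ} (hx : 1 < x) :
    HasDerivAt (fun x => Real.sin (α * Real.log x) ^ 2 / Real.log x)
      ((2 * Real.sin (α * Real.log x) * Real.cos (α * Real.log x) * α / Real.log x -
        Real.sin (α * Real.log x) ^ 2 / Real.log x ^ 2) / x) x := by
  have hl := Real.hasDerivAt_log (show x ≠ 0 by linarith)
  have hlog : Real.log x ≠ 0 := (Real.log_pos hx).ne'
  have h := (((hl.const_mul α).sin).pow 2).div hl hlog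
  convert! h using 1
  have hx0 : x ≠ 0 := by linarith
  field_simp
  simp
  ring

theorem abs_deriv_sin_sq_log_div_log_le (α : ℝ) {x : ℝ} (hx : 1 < x) :
    |(2 * Real.sin (α * Real.log x) * Real.cos (α * Real.log x) * α / Real.log x -
        Real.sin (α * Real.log x) ^ 2 / Real.log x ^ 2) / x| ≤ 3 * α ^ 2 / x := by
  have hx0 : 0 < x := by linarith
  have hl := Real.log_pos hx
  set l := Real.log x
  have h1 : |Real.sin (α * l)| ≤ |α| * l := by
    simpa [abs_mul, abs_of_pos hl] using Real.abs_sin_le_abs (x := α * l)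
  have h2 : |2 * Real.sin (α * l) * Real.cos (α * l) * α / l| ≤ 2 * α ^ 2 := by
    rw [abs_div, abs_of_pos hl, div_le_iff₀ hl, abs_mul, abs_mul, abs_mul, abs_two]
    calc 2 * |Real.sin (α * l)| * |Real.cos (α * l)| * |α| ≤ 2 * (|α| * l) * 1 * |α| := by
          gcongr
          exact Real.abs_cos_le_one _
      _ = 2 * α ^ 2 * l := by rw [← sq_abs α]; ring
  have h3 : |Real.sin (α * l) ^ 2 / l ^ 2| ≤ α ^ 2 := by
    rw [abs_of_nonneg (by positivity), div_le_iff₀ (by positivity), ← mul_pow]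
    exact sin_sq_le_sq _
  rw [abs_div, abs_of_pos hx0]
  gcongr
  exact (abs_sub _ _).trans (by linarith)

/-- Substitution `v = log x / L`. -/
theorem integral_sin_sq_log_div_log_div (t : ℝ) {L b : ℝ} (hL : 0 < L) (hb : 2 ≤ b) :
    ∫ x in (2 : ℝ)..b, Real.sin (t / (2 * L) * Real.log x) ^ 2 / Real.log x / x =
      ∫ v in (Real.log 2 / L)..(Real.log b / L), Real.sin (t * v / 2) ^ 2 / v := by
  have huIcc : Set.uIcc (2 : ℝ) b = Set.Icc 2 b := Set.uIcc_of_le hb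
  have h := intervalIntegral.integral_comp_mul_deriv' (a := 2) (b := b)
    (f := fun x => Real.log x / L) (f' := fun x => x⁻¹ / L)
    (g := fun v => Real.sin (t * v / 2) ^ 2 / v)
    (fun x hx => (Real.hasDerivAt_log (by rw [huIcc] at hx; linarith [hx.1])).div_const L)
    (fun x hx => ((continuousAt_inv₀ (by rw [huIcc] at hx; linarith [hx.1])).div_const
      L).continuousWithinAt)
    (by
      rintro _ ⟨x, hx, rfl⟩
      rw [huIcc] at hx
      have hpos : Real.log x / L ≠ 0 :=
        (div_pos (Real.log_pos (by linarith [hx.1])) hL).ne'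
      exact ContinuousAt.continuousWithinAt (by fun_prop (disch := exact hpos)))
  rw [← h]
  refine intervalIntegral.integral_congr fun x hx => ?_
  rw [huIcc] at hx
  have hl := (Real.log_pos (show 1 < x by linarith [hx.1])).ne'
  have hx0 : x ≠ 0 := by linarith [hx.1]
  simp only [Function.comp]
  rw [show t * (Real.log x / L) / 2 = t / (2 * L) * Real.log x by field_simp]
  field_simp

/-- The Riemann–Stieltjes sums of `sin² (t v / 2) / v` against the weights `log p / (p log N)` at
the points `log p / log N` converge to the integral over `[0, 1]`, with a rate. -/
theorem exists_abs_sum_sin_sq_sub_integral_le :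
    ∃ K : ℝ, 0 ≤ K ∧ ∀ (N : ℕ) (t : ℝ), 2 ≤ N →
      |∑ p ∈ (Finset.Iic N).subtype Nat.Prime,
          Real.sin (t * Real.log (p : ℕ) / (2 * Real.log N)) ^ 2 / (p : ℕ) -
        ∫ v in (0 : ℝ)..1, Real.sin (t * v / 2) ^ 2 / v| ≤ K * (1 + t ^ 2) / Real.log N := by
  obtain ⟨C, hC0, hC⟩ := exists_abs_sum_mul_sub_integral_div_le
  refine ⟨C + 2, by positivity, fun N t hN => ?_⟩
  have hN2 : (2 : ℝ) ≤ N := by exact_mod_cast hN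
  have hlog2 : 0 < Real.log 2 := Real.log_pos one_lt_two
  have hlog2' : Real.log 2 ≤ 1 := by linarith [Real.log_two_lt_d9]
  have hlogN : Real.log 2 ≤ Real.log N := Real.log_le_log two_pos hN2
  set L := Real.log N with hLdef
  have hL : 0 < L := by linarith
  set α := t / (2 * L) with hα
  -- Here `M = 3 α²` with `α = t / (2L)`, so the error term `M log N` is `(3/4) t² / L`.
  have hmain := hC N (fun x => Real.sin (α * Real.log x) ^ 2 / Real.log x) _ (3 * α ^ 2) hN
    (fun x hx => hasDerivAt_sin_sq_log_div_log α (by linarith [hx.1]))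
    (by
      intro x hx
      have h0 : x ≠ 0 := by linarith [hx.1]
      have h1 : Real.log x ≠ 0 := (Real.log_pos (by linarith [hx.1])).ne'
      have h2 : Real.log x ^ 2 ≠ 0 := pow_ne_zero 2 h1
      refine ContinuousAt.continuousWithinAt ?_
      have hl : ContinuousAt Real.log x := Real.continuousAt_log h0
      refine ContinuousAt.div (ContinuousAt.sub (ContinuousAt.div ?_ hl h1)
        (ContinuousAt.div ?_ (hl.pow 2) h2)) continuousAt_id h0
      · fun_prop
      · fun_prop)
    (fun x hx => abs_deriv_sin_sq_log_div_log_le α (by linarith [hx.1]))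
  rw [integral_sin_sq_log_div_log_div t hL hN2, ← hLdef, div_self hL.ne'] at hmain
  have hsum : ∑ p ∈ (Finset.Iic N).subtype Nat.Prime,
        Real.sin (t * Real.log (p : ℕ) / (2 * L)) ^ 2 / (p : ℕ) =
      ∑ k ∈ Finset.Icc 0 N, (fun x => Real.sin (α * Real.log x) ^ 2 / Real.log x) (k : ℝ) *
        (if k.Prime then Real.log k / k else 0) := by
    rw [Finset.sum_subtype_eq_sum_filter
      (fun k : ℕ => Real.sin (t * Real.log k / (2 * L)) ^ 2 / k), Finset.sum_filter]
    refine Finset.sum_congr (by ext; simp) fun k _ => ?_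
    split_ifs with hk
    · have h1 : (1 : ℝ) < k := by exact_mod_cast hk.one_lt
      have h2 := (Real.log_pos h1).ne'
      rw [show t * Real.log k / (2 * L) = α * Real.log k by rw [hα]; ring]
      field_simp
    · simp
  have hsplit := intervalIntegral.integral_add_adjacent_intervals
    (intervalIntegrable_sin_sq_div t le_rfl (show 0 ≤ Real.log 2 / L by positivity))
    (intervalIntegrable_sin_sq_div t (show 0 ≤ Real.log 2 / L by positivity)
      ((div_le_one hL).2 hlogN))
  -- The substitution only reaches down to `v = log 2 / L`; the missing initial piece is short and
  -- its integrand is bounded by `t²`.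
  have hsmall : |∫ v in (0 : ℝ)..(Real.log 2 / L), Real.sin (t * v / 2) ^ 2 / v| ≤ t ^ 2 / L := by
    have h := intervalIntegral.norm_integral_le_of_norm_le_const (a := 0) (b := Real.log 2 / L)
      (f := fun v => Real.sin (t * v / 2) ^ 2 / v) (C := t ^ 2) fun v hv => by
        rw [Set.uIoc_of_le (by positivity)] at hv
        have hv1 : v ≤ 1 := hv.2.trans ((div_le_one hL).2 hlogN)
        rw [Real.norm_of_nonneg (div_nonneg (sq_nonneg _) hv.1.le)]
        refine (sin_sq_div_le t hv.1.le).trans ?_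
        nlinarith [sq_nonneg t, hv.1]
    rw [sub_zero, abs_of_pos (by positivity)] at h
    refine h.trans ?_
    rw [mul_div_assoc']
    gcongr
    exact mul_le_of_le_one_right (sq_nonneg t) hlog2'
  have hfN : |Real.sin (α * L) ^ 2 / L| ≤ 1 / L := by
    rw [abs_of_nonneg (by positivity)]
    gcongr
    exact Real.sin_sq_le_one _
  have hM : 3 * α ^ 2 * L ≤ t ^ 2 / L := by
    rw [hα]
    rw [show 3 * (t / (2 * L)) ^ 2 * L = 3 / 4 * (t ^ 2 / L) by field_simp; ring]
    have : 0 ≤ t ^ 2 / L := by positivity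
    linarith
  have hf2 : |Real.sin (α * Real.log 2) ^ 2 / Real.log 2| * Real.log 2 ≤ t ^ 2 / L := by
    rw [abs_of_nonneg (by positivity), div_mul_cancel₀ _ hlog2.ne']
    refine (sin_sq_le_sq _).trans ?_
    rw [hα, show (t / (2 * L) * Real.log 2) ^ 2 =
      t ^ 2 / L * (Real.log 2 / L * Real.log 2 / 4) by field_simp; ring]
    refine mul_le_of_le_one_right (by positivity) ?_
    have h1 : Real.log 2 / L ≤ 1 := (div_le_one hL).2 hlogN
    have h2 : 0 ≤ Real.log 2 / L := by positivity
    nlinarith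
  rw [hsum, ← hsplit]
  rw [abs_le] at hmain hsmall ⊢
  have hCm := mul_le_mul_of_nonneg_left (add_le_add hfN hM) hC0
  have hR : (C + 2) * (1 + t ^ 2) / L = C * (1 / L + t ^ 2 / L) + 2 * (t ^ 2 / L) + 2 / L := by
    ring
  have hp : 0 < 2 / L := by positivity
  rw [hR]
  constructor <;> linarith [hmain.1, hmain.2, hsmall.1, hsmall.2]

/-! ### The characteristic function of `X_n` as a product -/

theorem charFun_map_of_three_values {Ω : Type*} [MeasurableSpace Ω] (P : Measure Ω)
    [IsProbabilityMeasure P] {f : Ω → ℝ} (hf : Measurable f) {a b : ℝ} (ha : 0 ≤ a) (hb : 0 ≤ b)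
    (hab : 2 * a + b = 1) (h1 : P {ω | f ω = 1} = ENNReal.ofReal a)
    (hm1 : P {ω | f ω = -1} = ENNReal.ofReal a) (h0 : P {ω | f ω = 0} = ENNReal.ofReal b)
    (s : ℝ) : charFun (P.map f) s = ((b + 2 * a * Real.cos s : ℝ) : ℂ) := by
  have hmeas : ∀ c : ℝ, MeasurableSet {ω | f ω = c} := fun c => hf (measurableSet_singleton c)
  -- The three probabilities sum to one, so all other values have probability zero.
  have hU : P ({ω | f ω = 1} ∪ {ω | f ω = -1} ∪ {ω | f ω = 0}) = 1 := by
    rw [measure_union ?_ (hmeas 0), measure_union ?_ (hmeas (-1)), h1, hm1, h0,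
      ← ENNReal.ofReal_add ha ha, ← ENNReal.ofReal_add (by positivity) hb,
      show a + a + b = 1 by linarith, ENNReal.ofReal_one]
    · refine Set.disjoint_left.2 fun ω h h' => ?_
      simp only [Set.mem_ofPred_eq] at h h'
      linarith
    · refine Set.disjoint_left.2 fun ω h h' => ?_
      simp only [Set.mem_ofPred_eq, Set.mem_union] at h h'
      rcases h with h | h <;> linarith
  have hae : (fun ω => Complex.exp (s * f ω * Complex.I)) =ᵐ[P]
      {ω | f ω = 1}.indicator (fun _ => Complex.exp (s * Complex.I)) +
      {ω | f ω = -1}.indicator (fun _ => Complex.exp (-(s * Complex.I))) +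
      {ω | f ω = 0}.indicator (fun _ => (1 : ℂ)) := by
    have : ∀ᵐ ω ∂P, ω ∈ {ω | f ω = 1} ∪ {ω | f ω = -1} ∪ {ω | f ω = 0} :=
      (prob_compl_eq_zero_iff (((hmeas 1).union (hmeas (-1))).union (hmeas 0))).2 hU
    filter_upwards [this] with ω hω
    rcases hω with (hω | hω) | hω <;> simp only [Set.mem_ofPred_eq] at hω <;>
      simp [Set.indicator, hω] <;> norm_num
  have hi : ∀ (c : ℝ) (z : ℂ), Integrable ({ω | f ω = c}.indicator fun _ => z) P := fun c z =>
    (integrable_const z).indicator (hmeas c)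
  rw [charFun_apply_real, integral_map hf.aemeasurable (by fun_prop), integral_congr_ae hae,
    integral_add' ((hi _ _).add (hi _ _)) (hi _ _), integral_add' (hi _ _) (hi _ _),
    integral_indicator_const _ (hmeas _), integral_indicator_const _ (hmeas _),
    integral_indicator_const _ (hmeas _)]
  simp only [Measure.real, h1, hm1, h0, ENNReal.toReal_ofReal ha, ENNReal.toReal_ofReal hb]
  simp only [Complex.real_smul]
  push_cast
  rw [Complex.cos]
  ring_nf

/-- The characteristic function of `∑_{p ≤ N} η_p log p`. -/
noncomputable def sqfProd (N : ℕ) (s : ℝ) : ℝ :=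
  ∏ p ∈ (Finset.Iic N).subtype Nat.Prime,
    (1 - 4 * (p : ℕ) / ((p : ℕ) + 1) ^ 2 * Real.sin (s * Real.log (p : ℕ) / 2) ^ 2)

theorem measurable_sqfSum {Ω : Type*} [MeasurableSpace Ω] {P : Measure Ω}
    {η : Nat.Primes → Ω → ℝ} (hη : IsSquarefreeModel P η) (n : ℕ) : Measurable (sqfSum η n) :=
  Finset.measurable_fun_sum _ fun p _ => (hη.measurable p).mul_const _

theorem charFun_map_sqfSum {Ω : Type*} [MeasurableSpace Ω] {P : Measure Ω}
    [IsProbabilityMeasure P] {η : Nat.Primes → Ω → ℝ} (hη : IsSquarefreeModel P η) (n : ℕ)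
    (s : ℝ) : charFun (P.map (sqfSum η n)) s = (sqfProd (primeSeq n) s : ℂ) := by
  have hind : iIndepFun (fun (p : Nat.Primes) ω => η p ω * Real.log (p : ℕ)) P :=
    hη.indep.comp (fun p x => x * Real.log (p : ℕ)) fun p => by fun_prop
  have h := iIndepFun.charFun_map_fun_finsetSum_eq_prod
    (s := (Finset.Iic (primeSeq n)).subtype Nat.Prime)
    (X := fun (p : Nat.Primes) ω => η p ω * Real.log (p : ℕ))
    (fun p _ => ((hη.measurable p).mul_const _).aemeasurable)
    (hind.precomp (g := Subtype.val) Subtype.val_injective)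
  have h' := congrFun h s
  rw [show sqfSum η n = fun ω => ∑ p ∈ (Finset.Iic (primeSeq n)).subtype Nat.Prime,
    η p ω * Real.log (p : ℕ) from rfl]
  refine h'.trans ?_
  rw [Finset.prod_apply, sqfProd, Complex.ofReal_prod]
  refine Finset.prod_congr rfl fun p _ => ?_
  have hp : (0 : ℝ) < (p : ℕ) := by exact_mod_cast p.2.pos
  have hthree := charFun_map_of_three_values P (hη.measurable p)
    (a := (p : ℕ) / ((p : ℕ) + 1) ^ 2) (b := ((p : ℕ) ^ 2 + 1) / ((p : ℕ) + 1) ^ 2)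
    (by positivity) (by positivity) (by field_simp; ring)
    (hη.prob_one p) (hη.prob_neg_one p) (hη.prob_zero p) (Real.log (p : ℕ) * s)
  have hmap : P.map (fun ω => η p ω * Real.log (p : ℕ)) =
      (P.map (η p)).map (fun x => Real.log (p : ℕ) * x) := by
    rw [Measure.map_map (by fun_prop) (hη.measurable p)]
    congr 1
    ext ω
    simp [mul_comm]
  rw [hmap, charFun_map_mul, hthree]
  congr 1
  -- With `2a + b = 1`, `b + 2a cos θ = 1 - 4a sin²(θ/2)`.
  rw [Real.sin_sq_eq_half_sub, show 2 * (s * Real.log (p : ℕ) / 2) = Real.log (p : ℕ) * s by ring]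
  field_simp
  ring

/-! ### Quadratic decay of the product -/

theorem sqfProd_factor_coeff_le_one {p : ℝ} (hp : 0 < p) : 4 * p / (p + 1) ^ 2 ≤ 1 := by
  rw [div_le_one (by positivity)]
  nlinarith [sq_nonneg (p - 1)]

theorem sqfProd_factor_mem_Icc {p : ℝ} (hp : 0 < p) (x : ℝ) :
    1 - 4 * p / (p + 1) ^ 2 * Real.sin x ^ 2 ∈ Set.Icc (0 : ℝ) 1 := by
  have h1 := sqfProd_factor_coeff_le_one hp
  have h2 : 0 ≤ 4 * p / (p + 1) ^ 2 := by positivity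
  have h3 := Real.sin_sq_le_one x
  have h4 := sq_nonneg (Real.sin x)
  constructor <;> nlinarith

theorem summable_primes_rpow_neg_two : Summable fun p : Nat.Primes => (p : ℝ) ^ (-2 : ℝ) :=
  Nat.Primes.summable_rpow.2 (by norm_num)

theorem sqfProd_nonneg (N : ℕ) (s : ℝ) : 0 ≤ sqfProd N s :=
  Finset.prod_nonneg fun p _ =>
    (sqfProd_factor_mem_Icc (show (0 : ℝ) < (p : ℕ) by exact_mod_cast p.2.pos) _).1

/-- Applied with `y = 1 - cos θ`, so that `y / 2 = sin²(θ/2)`: the coefficient becomes `4 / p` at a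
cost summable over primes. -/
theorem two_mul_div_sub_le_coeff_mul_half {p y : ℝ} (hp : 0 < p) (h0 : 0 ≤ y) (h2 : y ≤ 2) :
    2 * (y / p) - 8 * p ^ (-2 : ℝ) ≤ 4 * p / (p + 1) ^ 2 * (y / 2) := by
  have h : 2 / p - 2 * p / (p + 1) ^ 2 ≤ 4 / p ^ 2 := by
    rw [div_sub_div _ _ hp.ne' (by positivity), div_le_div_iff₀ (by positivity) (by positivity)]
    nlinarith [pow_pos hp 2, pow_pos hp 3]
  have hpow : p ^ (-2 : ℝ) = 1 / p ^ 2 := by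
    rw [Real.rpow_neg hp.le, one_div]
    norm_cast
  have h' : y * (2 / p - 2 * p / (p + 1) ^ 2) ≤ 2 * (4 / p ^ 2) :=
    (mul_le_mul_of_nonneg_left h h0).trans (mul_le_mul_of_nonneg_right h2 (by positivity))
  rw [hpow]
  linarith [show y * (2 / p - 2 * p / (p + 1) ^ 2) =
    2 * (y / p) - 4 * p / (p + 1) ^ 2 * (y / 2) by ring, show 2 * (4 / p ^ 2) = 8 * (1 / p ^ 2) by ring]

/-- Bound each factor by `1 - x ≤ exp(-x)`. Up to a constant the exponent is `-2 ∑ (1 - cos(s log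
p)) / p`, and this 2 becomes the power in the denominator. -/
theorem exists_sqfProd_le (k : ℝ) :
    ∃ C : ℝ, 0 < C ∧ ∀ (N : ℕ) (s : ℝ), 2 ≤ N → |s| ≤ k → s ≠ 0 →
      sqfProd N s ≤ C / (s * Real.log N) ^ 2 := by
  obtain ⟨C, hC⟩ := exists_log_mul_log_sub_le_sum_one_sub_cos k
  set D := ∑' p : Nat.Primes, (p : ℝ) ^ (-2 : ℝ) with hD
  refine ⟨Real.exp (2 * C + 8 * D), Real.exp_pos _, fun N s hN hs hs0 => ?_⟩
  have hL : 0 < Real.log N := Real.log_pos (by exact_mod_cast hN)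
  have hsum : 2 * (∑ p ∈ (Finset.Iic N).subtype Nat.Prime,
      (1 - Real.cos (s * Real.log (p : ℕ))) / (p : ℕ)) - 8 * D ≤
      ∑ p ∈ (Finset.Iic N).subtype Nat.Prime,
        4 * (p : ℕ) / ((p : ℕ) + 1 : ℝ) ^ 2 * Real.sin (s * Real.log (p : ℕ) / 2) ^ 2 := by
    have hDS : ∑ p ∈ (Finset.Iic N).subtype Nat.Prime, ((p : ℕ) : ℝ) ^ (-2 : ℝ) ≤ D :=
      Summable.sum_le_tsum (ι := Nat.Primes) _ (fun p _ => by positivity)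
        summable_primes_rpow_neg_two
    refine le_trans (sub_le_sub_left (mul_le_mul_of_nonneg_left hDS (by norm_num)) _) ?_
    rw [Finset.mul_sum, Finset.mul_sum, ← Finset.sum_sub_distrib]
    refine Finset.sum_le_sum fun p _ => ?_
    have hp : (0 : ℝ) < (p : ℕ) := by exact_mod_cast p.2.pos
    rw [Real.sin_sq_eq_half_sub, show 2 * (s * Real.log (p : ℕ) / 2) = s * Real.log (p : ℕ) by ring,
      show 1 / 2 - Real.cos (s * Real.log (p : ℕ)) / 2 =
        (1 - Real.cos (s * Real.log (p : ℕ))) / 2 by ring]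
    exact two_mul_div_sub_le_coeff_mul_half hp (sub_nonneg.2 (Real.cos_le_one _))
      (by linarith [Real.neg_one_le_cos (s * Real.log (p : ℕ))])
  have h := hC N s hN hs hs0
  calc sqfProd N s ≤ ∏ p ∈ (Finset.Iic N).subtype Nat.Prime,
        Real.exp (-(4 * (p : ℕ) / ((p : ℕ) + 1 : ℝ) ^ 2 *
          Real.sin (s * Real.log (p : ℕ) / 2) ^ 2)) := by
        refine Finset.prod_le_prod (fun p _ => (sqfProd_factor_mem_Icc
          (show (0 : ℝ) < (p : ℕ) by exact_mod_cast p.2.pos) _).1) fun p _ => ?_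
        exact Real.one_sub_le_exp_neg _
    _ = Real.exp (-∑ p ∈ (Finset.Iic N).subtype Nat.Prime, 4 * (p : ℕ) / ((p : ℕ) + 1 : ℝ) ^ 2 *
          Real.sin (s * Real.log (p : ℕ) / 2) ^ 2) := by
        rw [← Real.exp_sum, Finset.sum_neg_distrib]
    _ ≤ Real.exp (2 * C + 8 * D - 2 * Real.log (|s| * Real.log N)) :=
        Real.exp_le_exp.2 (by linarith)
    _ = Real.exp (2 * C + 8 * D) / (s * Real.log N) ^ 2 := by
        have hpos : 0 < |s| * Real.log N := mul_pos (abs_pos.2 hs0) hL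
        rw [Real.exp_sub, mul_comm 2 (Real.log _), Real.exp_mul, Real.exp_log hpos]
        norm_num [mul_pow]

/-! ### Convergence of the rescaled product to `φ`, with a rate -/

theorem abs_prod_sub_prod_le_sum {ι : Type*} (s : Finset ι) (f g : ι → ℝ)
    (hf : ∀ i ∈ s, |f i| ≤ 1) (hg : ∀ i ∈ s, |g i| ≤ 1) :
    |∏ i ∈ s, f i - ∏ i ∈ s, g i| ≤ ∑ i ∈ s, |f i - g i| := by
  classical
  induction s using Finset.induction_on with
  | empty => simp
  | insert a s ha ih =>
    rw [Finset.prod_insert ha, Finset.prod_insert ha, Finset.sum_insert ha]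
    have ih' := ih (fun i hi => hf i (Finset.mem_insert_of_mem hi))
      (fun i hi => hg i (Finset.mem_insert_of_mem hi))
    have hF : |∏ i ∈ s, f i| ≤ 1 := by
      rw [Finset.abs_prod]
      exact Finset.prod_le_one (fun _ _ => abs_nonneg _)
        fun i hi => hf i (Finset.mem_insert_of_mem hi)
    have hga := hg a (Finset.mem_insert_self a s)
    calc |f a * ∏ i ∈ s, f i - g a * ∏ i ∈ s, g i|
        = |(f a - g a) * ∏ i ∈ s, f i + g a * (∏ i ∈ s, f i - ∏ i ∈ s, g i)| := by ring_nf
      _ ≤ |f a - g a| * 1 + 1 * |∏ i ∈ s, f i - ∏ i ∈ s, g i| := by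
          refine (abs_add_le _ _).trans ?_
          rw [abs_mul, abs_mul]
          gcongr
      _ ≤ _ := by linarith

theorem abs_exp_neg_sub_one_sub_neg_le {u : ℝ} (hu : 0 ≤ u) : |1 - u - Real.exp (-u)| ≤ u ^ 2 := by
  rcases le_or_gt u 1 with h | h
  · have := Real.abs_exp_sub_one_sub_id_le (x := -u) (by rwa [abs_neg, abs_of_nonneg hu])
    rw [abs_sub_comm]
    rw [neg_sq] at this
    convert! this using 2
    ring
  · have h1 := Real.one_sub_le_exp_neg u
    have h2 : Real.exp (-u) ≤ 1 := Real.exp_le_one_iff.2 (by linarith)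
    rw [abs_le]
    constructor <;> nlinarith

theorem abs_exp_neg_sub_exp_neg_le {x y : ℝ} (hx : 0 ≤ x) (hy : 0 ≤ y) :
    |Real.exp (-x) - Real.exp (-y)| ≤ |x - y| := by
  have key : ∀ a b : ℝ, 0 ≤ a → Real.exp (-a) - Real.exp (-b) ≤ |a - b| := by
    intro a b ha
    have h1 : Real.exp (-b) = Real.exp (-a) * Real.exp (a - b) := by rw [← Real.exp_add]; ring_nf
    have h2 := Real.add_one_le_exp (a - b)
    have h3 : Real.exp (-a) ≤ 1 := Real.exp_le_one_iff.2 (by linarith)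
    have h4 := Real.exp_pos (-a)
    have h5 := neg_abs_le (a - b)
    have h6 := abs_nonneg (a - b)
    rw [h1]
    nlinarith
  rw [abs_le]
  have h1 := key x y hx
  have h2 := key y x hy
  rw [abs_sub_comm] at h2
  constructor <;> linarith

/-- The second-order error of the exponential gives `16 σ / p²` (as `σ² ≤ σ`), the change of
coefficient `8 σ / p²`. Keeping the factor `σ` matters: with `σ = sin²` of a small angle it brings
in `t² / L²`. -/
theorem abs_sqfProd_factor_sub_exp_le {p σ : ℝ} (hp : 1 ≤ p) (h0 : 0 ≤ σ) (h1 : σ ≤ 1) :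
    |1 - 4 * p / (p + 1) ^ 2 * σ - Real.exp (-(4 * (σ / p)))| ≤ 24 * σ / p ^ 2 := by
  have hp0 : 0 < p := by linarith
  have h := abs_exp_neg_sub_one_sub_neg_le (u := 4 * (σ / p)) (by positivity)
  have h2 : 0 ≤ 4 / p - 4 * p / (p + 1) ^ 2 := by
    rw [div_sub_div _ _ hp0.ne' (by positivity)]
    exact div_nonneg (by nlinarith) (by positivity)
  have h3 : 4 / p - 4 * p / (p + 1) ^ 2 ≤ 8 / p ^ 2 := by
    rw [div_sub_div _ _ hp0.ne' (by positivity), div_le_div_iff₀ (by positivity) (by positivity)]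
    nlinarith [pow_pos hp0 2, pow_pos hp0 3]
  have h4 : (4 * (σ / p)) ^ 2 ≤ 16 * σ / p ^ 2 := by
    rw [mul_pow, div_pow, ← mul_div_assoc]
    gcongr
    · norm_num
    · nlinarith
  calc _ = |(1 - 4 * (σ / p) - Real.exp (-(4 * (σ / p)))) +
        (4 / p - 4 * p / (p + 1) ^ 2) * σ| := by ring_nf
    _ ≤ 16 * σ / p ^ 2 + 8 / p ^ 2 * σ := by
        refine (abs_add_le _ _).trans (add_le_add (h.trans h4) ?_)
        rw [abs_of_nonneg (by positivity)]
        gcongr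
    _ = _ := by ring

theorem log_sq_div_sq_le {x : ℝ} (hx : 1 ≤ x) :
    Real.log x ^ 2 / x ^ 2 ≤ 16 * x ^ (-(3 / 2) : ℝ) := by
  have h0 : 0 < x := by linarith
  have hlog := Real.log_le_rpow_div h0.le (show (0 : ℝ) < 1 / 4 by norm_num)
  have hl0 := Real.log_nonneg hx
  have hsplit : x ^ (-(3 / 2) : ℝ) = (x ^ (1 / 4 : ℝ)) ^ 2 / x ^ 2 := by
    rw [← Real.rpow_natCast, ← Real.rpow_natCast, ← Real.rpow_mul h0.le, ← Real.rpow_sub h0]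
    norm_num
  rw [hsplit, ← mul_div_assoc]
  gcongr
  calc Real.log x ^ 2 ≤ (x ^ (1 / 4 : ℝ) / (1 / 4)) ^ 2 := by gcongr
    _ = _ := by ring

theorem integral_sin_sq_div_nonneg (t : ℝ) :
    0 ≤ ∫ v in (0 : ℝ)..1, Real.sin (t * v / 2) ^ 2 / v :=
  intervalIntegral.integral_nonneg zero_le_one fun _ hv => div_nonneg (sq_nonneg _) hv.1

/-- The characteristic function of `X_N / log N` converges to `φ`, with a rate. -/
theorem exists_abs_sqfProd_sub_sqfPhi_le :
    ∃ K : ℝ, 0 ≤ K ∧ ∀ (N : ℕ) (t : ℝ), 2 ≤ N →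
      |sqfProd N (t / Real.log N) - sqfPhi t| ≤ K * (1 + t ^ 2) / Real.log N := by
  obtain ⟨K, hK0, hK⟩ := exists_abs_sum_sin_sq_sub_integral_le
  have hZ : Summable fun p : Nat.Primes => (p : ℝ) ^ (-(3 / 2) : ℝ) :=
    Nat.Primes.summable_rpow.2 (by norm_num)
  set Z := ∑' p : Nat.Primes, (p : ℝ) ^ (-(3 / 2) : ℝ) with hZdef
  have hZ0 : 0 ≤ Z := tsum_nonneg fun p => by positivity
  refine ⟨192 * Z + 4 * K, by positivity, fun N t hN => ?_⟩
  have hN2 : (2 : ℝ) ≤ N := by exact_mod_cast hN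
  have hlog2 : 1 / 2 ≤ Real.log 2 := by linarith [Real.log_two_gt_d9]
  have hlogN : Real.log 2 ≤ Real.log N := Real.log_le_log two_pos hN2
  have hmain := hK N t hN
  set L := Real.log N with hLdef
  have hL : 0 < L := by linarith
  set S := (Finset.Iic N).subtype Nat.Prime with hS
  set σ : Nat.Primes → ℝ := fun p => Real.sin (t * Real.log (p : ℕ) / (2 * L)) ^ 2 with hσ
  have hσ0 : ∀ p, 0 ≤ σ p := fun p => sq_nonneg _
  have hσ1 : ∀ p, σ p ≤ 1 := fun p => Real.sin_sq_le_one _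
  have hp1 : ∀ p : Nat.Primes, (1 : ℝ) ≤ (p : ℕ) := fun p => by exact_mod_cast p.2.one_lt.le
  have hprod : sqfProd N (t / L) =
      ∏ p ∈ S, (1 - 4 * (p : ℕ) / ((p : ℕ) + 1 : ℝ) ^ 2 * σ p) := by
    refine Finset.prod_congr rfl fun p _ => ?_
    rw [hσ]
    congr 4
    field_simp
  have hexp : ∏ p ∈ S, Real.exp (-(4 * (σ p / (p : ℕ)))) =
      Real.exp (-(4 * ∑ p ∈ S, σ p / (p : ℕ))) := by
    rw [← Real.exp_sum, Finset.sum_neg_distrib, Finset.mul_sum]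
  have hfirst : |sqfProd N (t / L) - Real.exp (-(4 * ∑ p ∈ S, σ p / (p : ℕ)))| ≤
      192 * Z * t ^ 2 / L := by
    rw [hprod, ← hexp]
    refine (abs_prod_sub_prod_le_sum S _ _ ?_ ?_).trans ?_
    · intro p _
      have h := sqfProd_factor_mem_Icc (show (0 : ℝ) < (p : ℕ) by exact_mod_cast p.2.pos)
        (t * Real.log (p : ℕ) / (2 * L))
      exact abs_le.2 ⟨by linarith [h.1], h.2⟩
    · intro p _
      rw [Real.abs_exp]
      have := hσ0 p
      exact Real.exp_le_one_iff.2 (neg_nonpos.2 (by positivity))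
    · have hZS : ∑ p ∈ S, ((p : ℕ) : ℝ) ^ (-(3 / 2) : ℝ) ≤ Z :=
        Summable.sum_le_tsum (ι := Nat.Primes) _ (fun p _ => by positivity) hZ
      calc ∑ p ∈ S, |1 - 4 * (p : ℕ) / ((p : ℕ) + 1 : ℝ) ^ 2 * σ p -
              Real.exp (-(4 * (σ p / (p : ℕ))))|
          ≤ ∑ p ∈ S, 96 * t ^ 2 / L ^ 2 * ((p : ℕ) : ℝ) ^ (-(3 / 2) : ℝ) := by
            refine Finset.sum_le_sum fun p _ => ?_
            refine (abs_sqfProd_factor_sub_exp_le (hp1 p) (hσ0 p) (hσ1 p)).trans ?_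
            have h1 : σ p ≤ (t * Real.log (p : ℕ) / (2 * L)) ^ 2 := sin_sq_le_sq _
            have hpp : (0 : ℝ) < (p : ℕ) := by linarith [hp1 p]
            calc 24 * σ p / (p : ℕ) ^ 2
                ≤ 24 * (t * Real.log (p : ℕ) / (2 * L)) ^ 2 / (p : ℕ) ^ 2 := by gcongr
              _ = 6 * t ^ 2 / L ^ 2 * (Real.log (p : ℕ) ^ 2 / (p : ℕ) ^ 2) := by
                  field_simp; ring
              _ ≤ 6 * t ^ 2 / L ^ 2 * (16 * ((p : ℕ) : ℝ) ^ (-(3 / 2) : ℝ)) := by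
                  gcongr
                  exact log_sq_div_sq_le (hp1 p)
              _ = _ := by ring
        _ = 96 * t ^ 2 / L ^ 2 * ∑ p ∈ S, ((p : ℕ) : ℝ) ^ (-(3 / 2) : ℝ) := by
            rw [Finset.mul_sum]
        _ ≤ 96 * t ^ 2 / L ^ 2 * Z := by gcongr
        _ = 96 * Z * t ^ 2 / L * (1 / L) := by field_simp
        -- One of the two powers of `1 / L` is given up, through `L ≥ log 2 ≥ 1/2`, to match the
        -- weaker rate of the integral approximation.
        _ ≤ 96 * Z * t ^ 2 / L * 2 := by
            gcongr
            rw [div_le_iff₀ hL]; linarith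
        _ = _ := by ring
  have hsecond : |Real.exp (-(4 * ∑ p ∈ S, σ p / (p : ℕ))) - sqfPhi t| ≤
      4 * (K * (1 + t ^ 2) / L) := by
    rw [sqfPhi, neg_mul]
    refine (abs_exp_neg_sub_exp_neg_le ?_ ?_).trans ?_
    · exact mul_nonneg zero_le_four (Finset.sum_nonneg fun p _ =>
        div_nonneg (hσ0 p) (Nat.cast_nonneg _))
    · exact mul_nonneg zero_le_four (integral_sin_sq_div_nonneg t)
    · rw [← mul_sub, abs_mul, abs_of_nonneg (zero_le_four : (0 : ℝ) ≤ 4)]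
      exact mul_le_mul_of_nonneg_left hmain zero_le_four
  calc _ ≤ 192 * Z * t ^ 2 / L + 4 * (K * (1 + t ^ 2) / L) :=
        (abs_sub_le _ _ _).trans (add_le_add hfirst hsecond)
    _ ≤ 192 * Z * (1 + t ^ 2) / L + 4 * (K * (1 + t ^ 2) / L) := by
        gcongr
        linarith
    _ = _ := by ring

/-! ### Passage to the limit along the primes and existence of `μ` -/

theorem two_le_primeSeq (n : ℕ) : 2 ≤ primeSeq n :=
  (Nat.nth_mem_of_infinite Nat.infinite_setOfPred_prime n).two_le

theorem log_primeSeq_pos (n : ℕ) : 0 < Real.log (primeSeq n) :=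
  Real.log_pos (by exact_mod_cast two_le_primeSeq n)

theorem tendsto_log_primeSeq : Tendsto (fun n => Real.log (primeSeq n)) atTop atTop :=
  Real.tendsto_log_atTop.comp (tendsto_natCast_atTop_atTop.comp
    (Nat.nth_strictMono Nat.infinite_setOfPred_prime).tendsto_atTop)

theorem adjoint_apply_real (B : ℝ →L[ℝ] ℝ) (t : ℝ) : ContinuousLinearMap.adjoint B t = B t := by
  have h := ContinuousLinearMap.adjoint_inner_left B 1 t
  have hB : B t = t * B 1 := by simpa using B.map_smul t 1
  simp only [RCLike.inner_apply, conj_trivial, one_mul] at h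
  rw [h, hB, mul_comm]

theorem tendsto_const_div_log_primeSeq (c : ℝ) :
    Tendsto (fun n => c / Real.log (primeSeq n)) atTop (𝓝 0) :=
  tendsto_log_primeSeq.const_div_atTop c

theorem tendstoUniformlyOn_sqfProd {K : Set ℝ} (hK : IsCompact K) :
    TendstoUniformlyOn (fun n t => (sqfProd (primeSeq n) (t / Real.log (primeSeq n)) : ℂ))
      (fun t => (sqfPhi t : ℂ)) atTop K := by
  obtain ⟨C, hC0, hC⟩ := exists_abs_sqfProd_sub_sqfPhi_le
  obtain ⟨T, hT⟩ := hK.isBounded.exists_norm_le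
  rw [Metric.tendstoUniformlyOn_iff]
  intro ε hε
  filter_upwards [(tendsto_const_div_log_primeSeq (C * (1 + T ^ 2))).eventually (gt_mem_nhds hε)]
    with n hn t ht
  rw [dist_comm, Complex.dist_eq, ← Complex.ofReal_sub, Complex.norm_real]
  refine (hC _ t (two_le_primeSeq n)).trans_lt (lt_of_le_of_lt ?_ hn)
  have h1 : t ^ 2 ≤ T ^ 2 := sq_le_sq' (abs_le.1 (hT t ht)).1 (abs_le.1 (hT t ht)).2
  have := log_primeSeq_pos n
  gcongr

theorem tendsto_sqfProd (t : ℝ) :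
    Tendsto (fun n => sqfProd (primeSeq n) (t / Real.log (primeSeq n))) atTop (𝓝 (sqfPhi t)) := by
  have h := (tendstoUniformlyOn_sqfProd (isCompact_singleton (x := t))).tendsto_at
    (Set.mem_singleton t)
  exact (Complex.continuous_re.tendsto _).comp h

/-- Continuity at `0` is all that Lévy's theorem needs. The squeeze `exp(-t²) ≤ φ(t) ≤ 1` follows
from `sin²(t v / 2) / v ≤ t² / 4` on `(0, 1]`. -/
theorem continuousAt_sqfPhi_zero : ContinuousAt sqfPhi 0 := by
  have hle : ∀ t, sqfPhi t ≤ 1 := fun t => by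
    rw [sqfPhi, Real.exp_le_one_iff, neg_mul]
    linarith [integral_sin_sq_div_nonneg t]
  have hge : ∀ t, Real.exp (-t ^ 2) ≤ sqfPhi t := fun t => by
    rw [sqfPhi, Real.exp_le_exp]
    have h := intervalIntegral.norm_integral_le_of_norm_le_const (a := 0) (b := 1)
      (f := fun v => Real.sin (t * v / 2) ^ 2 / v) (C := t ^ 2 / 4) fun v hv => by
        rw [Set.uIoc_of_le zero_le_one] at hv
        rw [Real.norm_of_nonneg (div_nonneg (sq_nonneg _) hv.1.le)]
        exact (sin_sq_div_le t hv.1.le).trans (mul_le_of_le_one_right (by positivity) hv.2)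
    rw [sub_zero, abs_one, mul_one] at h
    linarith [(abs_le.1 h).2]
  have h0 : sqfPhi 0 = 1 := by simp [sqfPhi]
  rw [ContinuousAt, h0]
  refine tendsto_of_tendsto_of_tendsto_of_le_of_le ?_ tendsto_const_nhds hge hle
  have : Continuous fun t : ℝ => Real.exp (-t ^ 2) := by fun_prop
  simpa using this.tendsto 0

/-- Lévy's continuity theorem: continuity of the limit at `0` gives tightness, Prokhorov a weakly
convergent subsequence, and the characteristic function of its limit must be `f`. -/
theorem exists_probabilityMeasure_charFun_eq_of_tendsto (ν : ℕ → ProbabilityMeasure ℝ) {f : ℝ → ℂ}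
    (hf : ContinuousAt f 0)
    (h : ∀ t, Tendsto (fun n => charFun (ν n : Measure ℝ) t) atTop (𝓝 (f t))) :
    ∃ μ : ProbabilityMeasure ℝ, ∀ t, charFun (μ : Measure ℝ) t = f t := by
  have htight : IsTightMeasureSet
      {((μ : ProbabilityMeasure ℝ) : Measure ℝ) | μ ∈ Set.range ν} := by
    have := isTightMeasureSet_of_tendsto_charFun (μ := fun n => (ν n : Measure ℝ)) hf h
    convert! this using 1
    ext x
    simp
  obtain ⟨μ, -, φ, hφ, hμ⟩ := (isCompact_closure_of_isTightMeasureSet htight).tendsto_subseq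
    (x := ν) fun n => subset_closure (Set.mem_range_self n)
  refine ⟨μ, fun t => ?_⟩
  exact tendsto_nhds_unique (ProbabilityMeasure.tendsto_iff_tendsto_charFun.1 hμ t)
    ((h t).comp hφ.tendsto_atTop)

theorem exists_charFun_eq_sqfPhi {Ω : Type*} [MeasurableSpace Ω] {P : Measure Ω}
    [IsProbabilityMeasure P] {η : Nat.Primes → Ω → ℝ} (hη : IsSquarefreeModel P η) :
    ∃ μ : ProbabilityMeasure ℝ, ∀ t, charFun (μ : Measure ℝ) t = (sqfPhi t : ℂ) := by
  have hX : ∀ n, Measurable fun ω => (Real.log (primeSeq n))⁻¹ * sqfSum η n ω := fun n =>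
    (measurable_sqfSum hη n).const_mul _
  refine exists_probabilityMeasure_charFun_eq_of_tendsto
    (fun n => ⟨P.map fun ω => (Real.log (primeSeq n))⁻¹ * sqfSum η n ω,
      Measure.isProbabilityMeasure_map (hX n).aemeasurable⟩)
    (Complex.continuous_ofReal.continuousAt.comp continuousAt_sqfPhi_zero) fun t => ?_
  refine ((Complex.continuous_ofReal.tendsto _).comp (tendsto_sqfProd t)).congr fun n => ?_
  have hmap : P.map (fun ω => (Real.log (primeSeq n))⁻¹ * sqfSum η n ω) =
      (P.map (sqfSum η n)).map fun x => (Real.log (primeSeq n))⁻¹ * x := by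
    rw [Measure.map_map (by fun_prop) (measurable_sqfSum hη n)]
    rfl
  simp only [ProbabilityMeasure.coe_mk, hmap]
  rw [charFun_map_mul, charFun_map_sqfSum hη, Function.comp, div_eq_inv_mul]

/-! ### Decay of `φ`, integrability and tails -/

theorem exists_sqfProd_div_log_le (k : ℝ) :
    ∃ C : ℝ, 0 < C ∧ ∀ (n : ℕ) (t : ℝ), |t / Real.log (primeSeq n)| ≤ k → t ≠ 0 →
      sqfProd (primeSeq n) (t / Real.log (primeSeq n)) ≤ C / t ^ 2 := by
  obtain ⟨C, hC0, hC⟩ := exists_sqfProd_le k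
  refine ⟨C, hC0, fun n t ht ht0 => ?_⟩
  have hL := log_primeSeq_pos n
  have h := hC (primeSeq n) _ (two_le_primeSeq n) ht (div_ne_zero ht0 hL.ne')
  rwa [div_mul_cancel₀ _ hL.ne'] at h

/-- For fixed `t`, eventually `|t| ≤ log p_n`, so the product bound with `k = 1` holds with a
constant independent of `t` and passes to the limit. -/
theorem exists_abs_sqfPhi_le : ∃ C : ℝ, 0 < C ∧ ∀ t : ℝ, t ≠ 0 → |sqfPhi t| ≤ C / t ^ 2 := by
  obtain ⟨C, hC0, hC⟩ := exists_sqfProd_div_log_le 1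
  refine ⟨C, hC0, fun t ht => ?_⟩
  rw [abs_of_pos (by rw [sqfPhi]; exact Real.exp_pos _)]
  refine le_of_tendsto (tendsto_sqfProd t) ?_
  filter_upwards [tendsto_log_primeSeq.eventually_ge_atTop |t|] with n hn
  refine hC n t ?_ ht
  have hL := log_primeSeq_pos n
  rw [abs_div, abs_of_pos hL]
  exact (div_le_one hL).2 hn

theorem div_sq_le_of_one_le_abs {C t : ℝ} (hC : 0 ≤ C) (ht : 1 ≤ |t|) :
    C / t ^ 2 ≤ 2 * C * (1 + t ^ 2)⁻¹ := by
  have h1 : 1 ≤ t ^ 2 := by rw [← sq_abs]; nlinarith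
  rw [← div_eq_mul_inv, div_le_div_iff₀ (by linarith) (by linarith)]
  nlinarith

theorem integrable_sqfPhi {μ : ProbabilityMeasure ℝ}
    (hμ : ∀ t, charFun (μ : Measure ℝ) t = (sqfPhi t : ℂ)) : Integrable sqfPhi volume := by
  obtain ⟨C, hC0, hC⟩ := exists_abs_sqfPhi_le
  have hmeas : Measurable sqfPhi := by
    have h : sqfPhi = fun t => (charFun (μ : Measure ℝ) t).re := by
      ext t; simp [hμ]
    rw [h]
    exact Complex.measurable_re.comp measurable_charFun
  refine Integrable.mono' (g := fun t => 2 * (1 + C) * (1 + t ^ 2)⁻¹)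
    (integrable_inv_one_add_sq.const_mul _) hmeas.aestronglyMeasurable
    (Eventually.of_forall fun t => ?_)
  rcases le_or_gt 1 |t| with ht | ht
  · have ht0 : t ≠ 0 := fun h => by norm_num [h] at ht
    refine (hC t ht0).trans ((div_sq_le_of_one_le_abs hC0.le ht).trans ?_)
    gcongr
    linarith
  · have h1 : ‖sqfPhi t‖ ≤ 1 := by
      have h := norm_charFun_le_one (μ := (μ : Measure ℝ)) t
      rwa [hμ, Complex.norm_real] at h
    have h2 : t ^ 2 ≤ 1 := by rw [← sq_abs]; nlinarith [abs_nonneg t]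
    refine h1.trans ?_
    rw [← div_eq_mul_inv, le_div_iff₀ (by positivity)]
    linarith

/-- Dominated convergence: for `a ≥ 1` the integrand lies below a multiple of `1 / (1 + t²)`, and
each fixed `t` eventually leaves the domain. -/
theorem tendsto_setLIntegral_div_sq {C : ℝ} (hC : 0 ≤ C) :
    Tendsto (fun a : ℝ => ∫⁻ t in {t : ℝ | a ≤ ‖t‖}, ENNReal.ofReal (C / t ^ 2)) atTop (𝓝 0) := by
  have hms : ∀ a : ℝ, MeasurableSet {t : ℝ | a ≤ ‖t‖} := fun a =>
    measurableSet_le measurable_const measurable_norm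
  simp_rw [← lintegral_indicator (hms _)]
  rw [show (0 : ENNReal) = ∫⁻ _ : ℝ, 0 by simp]
  refine tendsto_lintegral_filter_of_dominated_convergence
    (fun t => ENNReal.ofReal (2 * C * (1 + t ^ 2)⁻¹)) ?_ ?_ ?_ ?_
  · exact Eventually.of_forall fun a => Measurable.indicator (by fun_prop) (hms a)
  · filter_upwards [eventually_ge_atTop (1 : ℝ)] with a ha
    refine Eventually.of_forall fun t => ?_
    by_cases ht : t ∈ {t : ℝ | a ≤ ‖t‖}
    · rw [Set.indicator_of_mem ht]
      exact ENNReal.ofReal_le_ofReal (div_sq_le_of_one_le_abs hC (ha.trans ht))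
    · rw [Set.indicator_of_notMem ht]
      exact zero_le
  · exact ((integrable_inv_one_add_sq.const_mul (2 * C)).lintegral_lt_top).ne
  · refine Eventually.of_forall fun t => tendsto_const_nhds.congr' ?_
    filter_upwards [eventually_gt_atTop ‖t‖] with a ha
    rw [Set.indicator_of_notMem (by simpa using ha)]

theorem mainTheorem4 {Ω : Type*} [MeasurableSpace Ω] (P : Measure Ω) [IsProbabilityMeasure P]
    (η : Nat.Primes → Ω → ℝ) (hη : IsSquarefreeModel P η) :
    Integrable sqfPhi volume ∧
    (∃ C : ℝ, 0 ≤ C ∧ ∀ t : ℝ, t ≠ 0 → |sqfPhi t| ≤ C * |t| ^ (-2 : ℤ)) ∧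
    ∃ μ : ProbabilityMeasure ℝ,
      (∀ t : ℝ, charFun (μ : Measure ℝ) t = (sqfPhi t : ℂ)) ∧
      ∃ A : ℕ → ℝ ≃L[ℝ] ℝ,
        (∀ (n : ℕ) (t : ℝ), A n t = Real.log (primeSeq n) * t ∧
          ContinuousLinearMap.adjoint (A n : ℝ →L[ℝ] ℝ) t = Real.log (primeSeq n) * t) ∧
        ModConvergence P (sqfSum η) A μ := by
  obtain ⟨μ, hμ⟩ := exists_charFun_eq_sqfPhi hη
  have hint := integrable_sqfPhi hμ
  refine ⟨hint, ?_, μ, hμ, ?_⟩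
  · obtain ⟨C, hC0, hC⟩ := exists_abs_sqfPhi_le
    refine ⟨C, hC0.le, fun t ht => (hC t ht).trans_eq ?_⟩
    rw [zpow_neg, ← div_eq_mul_inv]
    norm_cast
    rw [sq_abs]
  have hL : ∀ n, Real.log (primeSeq n) ≠ 0 := fun n => (log_primeSeq_pos n).ne'
  set A : ℕ → ℝ ≃L[ℝ] ℝ := fun n =>
    ContinuousLinearEquiv.unitsEquivAut ℝ (Units.mk0 (Real.log (primeSeq n)) (hL n)) with hA
  have hAapp : ∀ n t, A n t = Real.log (primeSeq n) * t := fun n t => by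
    simp [hA, mul_comm]
  have hsymm : ∀ n t, (A n).symm t = t / Real.log (primeSeq n) := fun n t => by
    rw [ContinuousLinearEquiv.symm_apply_eq, hAapp, mul_div_cancel₀ _ (hL n)]
  have hadj : ∀ n t, ContinuousLinearMap.adjoint ((A n).symm : ℝ →L[ℝ] ℝ) t =
      t / Real.log (primeSeq n) := fun n t => by
    rw [adjoint_apply_real, ContinuousLinearEquiv.coe_coe, hsymm]
  refine ⟨A, fun n t => ⟨hAapp n t, ?_⟩, ?_⟩
  · rw [adjoint_apply_real, ContinuousLinearEquiv.coe_coe, hAapp]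
  have hphi : charFun (μ : Measure ℝ) = fun t => (sqfPhi t : ℂ) := funext hμ
  refine ⟨fun n => (measurable_sqfSum hη n).aemeasurable, ?_, ?_, fun K hK => ?_, fun k _ => ?_⟩
  · rw [hphi]
    exact hint.ofReal
  · refine squeeze_zero_norm (fun n => ?_) (tendsto_const_div_log_primeSeq 1)
    refine ContinuousLinearMap.opNorm_le_bound _ (by have := log_primeSeq_pos n; positivity)
      fun t => le_of_eq ?_
    rw [ContinuousLinearEquiv.coe_coe, hsymm, norm_div,
      Real.norm_of_nonneg (log_primeSeq_pos n).le]
    ring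
  · simp only [hadj, charFun_map_sqfSum hη, hphi]
    exact tendstoUniformlyOn_sqfProd hK
  · simp only [hadj, charFun_map_sqfSum hη]
    obtain ⟨C, hC0, hC⟩ := exists_sqfProd_div_log_le k
    refine tendsto_of_tendsto_of_tendsto_of_le_of_le' tendsto_const_nhds
      (tendsto_setLIntegral_div_sq hC0.le) (Eventually.of_forall fun _ => zero_le) ?_
    -- Positivity of `a` keeps `t = 0`, where the bound `C / t²` is unavailable, out of the domain.
    -- The constant depends on `k` alone, so the supremum over `n` costs nothing.
    filter_upwards [eventually_gt_atTop (0 : ℝ)] with a ha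
    refine iSup_le fun n => ?_
    have hms : MeasurableSet {t : ℝ | a ≤ ‖t‖ ∧ ‖t / Real.log (primeSeq n)‖ ≤ k} :=
      (measurableSet_le measurable_const measurable_norm).inter
        (measurableSet_le (measurable_id.div_const _).norm measurable_const)
    refine (setLIntegral_mono' hms fun t ht => ?_).trans
      (lintegral_mono_set (t := {t : ℝ | a ≤ ‖t‖}) fun t ht => ht.1)
    have ht0 : t ≠ 0 := norm_pos_iff.1 (ha.trans_le ht.1)
    rw [← ofReal_norm, Complex.norm_real, Real.norm_of_nonneg (sqfProd_nonneg _ _)]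
    exact ENNReal.ofReal_le_ofReal (hC n t ht.2 ht0)
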